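/- Theorem 5.4. Let $m\ge 1$ and let $\Gamma\subset\mathbb R^m\times\mathbb R$ be a lattice such that the coordinate projections $p_1:\Gamma\to\mathbb R^m$ and $p_2:\Gamma\to\mathbb R$ are both injective and have dense image. Let $\Gamma^*=\{\eta\in\mathbb R^m\times\mathbb R : \gamma\cdot\eta\in\mathbb Z \text{ for all }\gamma\in\Gamma\}$ be the dual lattice, with coordinate projections $p_1^*:\Gamma^*\to\mathbb R^m$ and $p_2^*:\Gamma^*\to\mathbb R$. Let $\Omega\subset\mathbb R$ be a nondegenerate compact interval, symmetric around the origin, whose boundary does not meet $p_2(\Gamma)$, and let $\Lambda(\Omega)=\{p_1(\gamma):\gamma\in\Gamma,\ p_2(\gamma)\in\Omega\}$ be the corresponding (simple, generic) model set. Fix $0<\epsilon<1$, write $|\cdot|$ for the length of a subset of $\mathbb R$, $\operatorname{sinc}(t)=\frac{\sin \pi t}{\pi t}$ (with $\operatorname{sinc}(0)=1$) and $\Omega_n=(1-\epsilon^n)\Omega$, and put $$\Psi(t)=\lim_{n\to\infty}\prod_{s=0}^\infty \operatorname{sinc}\bigl(t\,|\epsilon^{ns}\Omega_n|\bigr)\quad\text{(a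 uniform limit)},\qquad \Phi=|\Omega|\,(\Psi*\Psi).$$ For $x,\omega\in\mathbb R^m$ let $T_xf(t)=f(t-x)$ and $M_\omega f(t)=e^{2\pi i\omega\cdot t}f(t)$, and let $\langle f,g\rangle=\int f\overline g$ on $L^2(\mathbb R^m)$. Let $W(L^2,\ell^1)$ be the space of measurable $f$ with $\sum_{k\in\mathbb Z^m}\|f\,\mathbf 1_{k+[0,1]^m}\|_2<\infty$. Let $A\in GL_m(\mathbb R)$ and $g_1,\dots,g_L,h_1,\dots,h_L\in W(L^2,\ell^1)$, and consider the Gabor system $$\mathcal G(g,\Lambda(\Omega),A\mathbb Z^m)=\{T_\lambda M_{An}g_l : 1\le l\le L,\ \lambda\in\Lambda(\Omega),\ n\in\mathbb Z^m\}$$ and, likewise, $\mathcal G(h,\Lambda(\Omega),A\mathbb Z^m)$. Assume that both are Bessel sequences for $L^2(\mathbb R^m)$, that is, for each of them there is $B>0$ such that the sum of $|\langle f,e\rangle|^2$ over the members $e$ of the system is at most $B\|f\|_2^2$ for all $f\in L^2(\mathbb R^m)$. Then the density $$D(\Lambda(\Omega))=\lim_{R\to\infty}\frac{\#\bigl(\Lambda(\Omega)\cap(x+R[0,1]^m)\bigr)}{R^m}$$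 exists and does not depend on $x\in\mathbb R^m$, and $\mathcal G(h,\Lambda(\Omega),A\mathbb Z^m)$ is a dual system to $\mathcal G(g,\Lambda(\Omega),A\mathbb Z^m)$, that is, $$f=\sum_{l=1}^L\sum_{\lambda\in\Lambda(\Omega)}\sum_{n\in\mathbb Z^m}\langle f,T_\lambda M_{An}g_l\rangle\,T_\lambda M_{An}h_l\quad\text{for all } f\in L^2(\mathbb R^m)$$ (with unconditional convergence in $L^2(\mathbb R^m)$), if and only if $$D(\Lambda(\Omega))\,|\det A|^{-1}\,\Phi(-p_2^*(\eta))\sum_{l=1}^L\bigl\langle T_{A^{-T}v}M_{p_1^*(\eta)}h_l,\,g_l\bigr\rangle=\delta_{\eta,0}\,\delta_{v,0}$$ for all $\eta\in\Gamma^*$ and $v\in\mathbb Z^m$, where $A^{-T}=(A^T)^{-1}$. -/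

import Mathlib

open MeasureTheory Filter Topology
open scoped ENNReal Pointwise

namespace ModelSetGabor

noncomputable section

/-- The Euclidean space `ℝ^m`. -/
abbrev Eucl (m : ℕ) : Type := EuclideanSpace ℝ (Fin m)

/-- The Hilbert space `L²(ℝ^m)` of complex-valued functions. -/
abbrev L2 (m : ℕ) : Type := Lp ℂ 2 (volume : Measure (Eucl m))

/-! ### Time-frequency shifts -/

/-- Translation `(T_x f)(t) = f (t - x)` on `L²(ℝ^m)`. -/
def translation {m : ℕ} (x : Eucl m) (f : L2 m) : L2 m :=
  Lp.compMeasurePreserving (fun t : Eucl m => t - x) (measurePreserving_sub_right volume x) f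

/-- The character `t ↦ exp(2πi b·t)`. -/
def character {m : ℕ} (b t : Eucl m) : ℂ :=
  Complex.exp (2 * Real.pi * Complex.I * ((inner ℝ b t : ℝ) : ℂ))

lemma norm_character {m : ℕ} (b t : Eucl m) : ‖character b t‖ = 1 := by
  have h : 2 * Real.pi * Complex.I * ((inner ℝ b t : ℝ) : ℂ)
      = ((2 * Real.pi * inner ℝ b t : ℝ) : ℂ) * Complex.I := by
    push_cast; ring
  rw [character, h, Complex.norm_exp_ofReal_mul_I]

lemma continuous_character {m : ℕ} (b : Eucl m) : Continuous (character b) := by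
  unfold character
  fun_prop

lemma memLp_character_mul {m : ℕ} (b : Eucl m) (f : L2 m) :
    MemLp (fun t => character b t * f t) 2 (volume : Measure (Eucl m)) := by
  refine (Lp.memLp f).of_le
    ((continuous_character b).aestronglyMeasurable.mul (Lp.aestronglyMeasurable f)) ?_
  filter_upwards with t
  rw [norm_mul, norm_character, one_mul]

/-- Modulation `(M_b f)(t) = exp(2πi b·t) f(t)` on `L²(ℝ^m)`. -/
def modulation {m : ℕ} (b : Eucl m) (f : L2 m) : L2 m :=
  (memLp_character_mul b f).toLp (fun t => character b t * f t)

/-! ### The Wiener amalgam space -/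

/-- The cube `B(x, R) = x + R [0,1]^m`. -/
def cube {m : ℕ} (x : Eucl m) (R : ℝ) : Set (Eucl m) :=
  {t | ∀ i, x i ≤ t i ∧ t i ≤ x i + R}

/-- The norm `∑_{k ∈ ℤ^m} ‖f 1_{k + [0,1]^m}‖_p` of the Wiener amalgam space `W(L^p, ℓ¹)`,
with values in `[0, ∞]`. -/
def amalgamNorm {m : ℕ} (p : ℝ≥0∞) (f : Eucl m → ℂ) : ℝ≥0∞ :=
  ∑' k : Fin m → ℤ,
    eLpNorm f p (volume.restrict (cube (WithLp.toLp 2 fun i => (k i : ℝ)) 1))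

/-- `f ∈ W(L², ℓ¹)`. -/
def MemAmalgam {m : ℕ} (f : L2 m) : Prop :=
  amalgamNorm 2 (f : Eucl m → ℂ) < ∞

/-! ### Lattices and model sets -/

/-- The conditions on the position of a lattice `Γ ⊂ ℝ^m × ℝ`: both coordinate projections are
injective on `Γ` and have dense image. -/
structure IsCutAndProject {m : ℕ} (Γ : Submodule ℤ (Eucl m × ℝ)) : Prop where
  injOn_fst : Set.InjOn Prod.fst (Γ : Set (Eucl m × ℝ))
  injOn_snd : Set.InjOn Prod.snd (Γ : Set (Eucl m × ℝ))
  dense_fst : Dense (Prod.fst '' (Γ : Set (Eucl m × ℝ)))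
  dense_snd : Dense (Prod.snd '' (Γ : Set (Eucl m × ℝ)))

/-- The dual lattice `Γ* = {η : γ·η ∈ ℤ for all γ ∈ Γ}`. -/
def dualLattice {m : ℕ} (Γ : Submodule ℤ (Eucl m × ℝ)) : Submodule ℤ (Eucl m × ℝ) where
  carrier := {η | ∀ γ ∈ Γ, ∃ k : ℤ, inner ℝ γ.1 η.1 + γ.2 * η.2 = k}
  zero_mem' := fun γ _ => ⟨0, by simp⟩
  add_mem' := by
    intro a b ha hb γ hγ
    obtain ⟨k, hk⟩ := ha γ hγ
    obtain ⟨l, hl⟩ := hb γ hγ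
    refine ⟨k + l, ?_⟩
    rw [Prod.fst_add, Prod.snd_add, inner_add_right]
    push_cast
    linarith
  smul_mem' := by
    intro c a ha γ hγ
    obtain ⟨k, hk⟩ := ha γ hγ
    refine ⟨c * k, ?_⟩
    rw [Prod.smul_fst, Prod.smul_snd, ← Int.cast_smul_eq_zsmul ℝ c a.1,
      ← Int.cast_smul_eq_zsmul ℝ c a.2, real_inner_smul_right, smul_eq_mul]
    push_cast
    rw [← hk]
    ring

/-- A window in `ℝ` that is a (nondegenerate, compact) interval: compact, non-empty, equal to the
closure of its interior, with boundary of Lebesgue measure zero. -/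
structure IsIntervalWindow (Ω : Set ℝ) : Prop where
  nonempty : Ω.Nonempty
  isCompact : IsCompact Ω
  closure_interior : closure (interior Ω) = Ω
  null_frontier : volume (frontier Ω) = 0
  ordConnected : Ω.OrdConnected

/-- The model set `Λ(Ω) = {p₁(γ) : γ ∈ Γ, p₂(γ) ∈ Ω}`. -/
def modelSet {m : ℕ} (Γ : Submodule ℤ (Eucl m × ℝ)) (Ω : Set ℝ) : Set (Eucl m) :=
  {x | ∃ γ ∈ Γ, γ.2 ∈ Ω ∧ γ.1 = x}

/-- `Λ(Ω)` is generic: `p₂(Γ)` does not meet the boundary of `Ω`. -/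
def IsGeneric {m : ℕ} (Γ : Submodule ℤ (Eucl m × ℝ)) (Ω : Set ℝ) : Prop :=
  ∀ γ ∈ Γ, γ.2 ∉ frontier Ω

/-- `Λ` is locally finite and has density `d`, that is
`#(Λ ∩ B(x, R)) / R^m → d` as `R → ∞`, for every `x ∈ ℝ^m`. -/
def HasDensity {m : ℕ} (Λ : Set (Eucl m)) (d : ℝ) : Prop :=
  (∀ x R, (Λ ∩ cube x R).Finite) ∧
  ∀ x, Tendsto (fun R : ℝ => ((Λ ∩ cube x R).ncard : ℝ) / R ^ m) atTop (𝓝 d)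

/-! ### The function `Φ` -/

/-- `∏_{s ≥ 0} sinc(t |ε^{ns} Ω_n|)` with `Ω_n = (1 - ε^n) Ω`, where `|·|` is the length and
`sinc u = sin(πu)/(πu)` (Mathlib's `Real.sinc` has no factor `π`). -/
def psiHat (Ω : Set ℝ) (ε : ℝ) (n : ℕ) (t : ℝ) : ℝ :=
  ∏' s : ℕ, Real.sinc (Real.pi * (t * volume.real (ε ^ (n * s) • ((1 - ε ^ n) • Ω))))

/-- `Ψ = lim_n psiHat Ω ε n`; the limit exists, and is uniform, by `tendstoUniformly_psiHat`. -/
def Psi (Ω : Set ℝ) (ε : ℝ) (t : ℝ) : ℝ :=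
  limUnder atTop fun n => psiHat Ω ε n t

/-- `Φ = |Ω| (Ψ * Ψ)`, with the convolution on `ℝ`. -/
def Phi (Ω : Set ℝ) (ε : ℝ) (t : ℝ) : ℝ :=
  volume.real Ω * ∫ u, Psi Ω ε u * Psi Ω ε (t - u)

lemma abs_sinc_sub_one_le (x : ℝ) : |Real.sinc x - 1| ≤ |x| := by
  rcases eq_or_ne x 0 with rfl | hx
  · simp
  have hx' : 0 < |x| := abs_pos.mpr hx
  rcases le_or_gt 2 |x| with h2 | h2
  · have h := abs_le.mp (Real.abs_sinc_le_one x)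
    exact (abs_le.mpr ⟨by linarith, by linarith⟩)
  have key : ∀ y : ℝ, 0 < y → y < 2 → |Real.sinc y - 1| ≤ y := by
    intro y hy hy2
    have h1 := Real.sin_gt_sub_cube hy
    have h2 := Real.sin_lt hy
    rw [Real.sinc_of_ne_zero hy.ne', div_sub_one hy.ne', abs_div, abs_of_pos hy,
      div_le_iff₀ hy, abs_le]
    constructor <;> nlinarith [mul_pos hy hy]
  rcases abs_cases x with ⟨he, _⟩ | ⟨he, _⟩
  · rw [he]; exact key x (he ▸ hx') (he ▸ h2)
  · rw [he, ← Real.sinc_neg]; exact key (-x) (he ▸ hx') (he ▸ h2)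

lemma abs_prod_sub_one_le (f : ℕ → ℝ) (hf : ∀ s, |f s| ≤ 1) (S : Finset ℕ) :
    |∏ s ∈ S, f s - 1| ≤ ∑ s ∈ S, |f s - 1| := by
  classical
  induction S using Finset.induction_on with
  | empty => simp
  | insert a S ha ih =>
    rw [Finset.prod_insert ha, Finset.sum_insert ha]
    have h : f a * ∏ s ∈ S, f s - 1 = (f a - 1) + f a * (∏ s ∈ S, f s - 1) := by ring
    rw [h]
    refine (abs_add_le _ _).trans (add_le_add le_rfl ?_)
    rw [abs_mul]
    exact (mul_le_of_le_one_left (abs_nonneg _) (hf a)).trans ih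

lemma abs_sinc_mul_sub_sinc_le {a : ℝ} (ha : 0 < a) (ha1 : a ≤ 1) (x : ℝ) :
    |Real.sinc (x * a) - Real.sinc x| ≤ 2 * (1 - a) / a := by
  rcases eq_or_ne x 0 with rfl | hx
  · simp only [zero_mul, sub_self, abs_zero]
    exact div_nonneg (by linarith) ha.le
  have hx' : 0 < |x| := abs_pos.mpr hx
  rw [Real.sinc_of_ne_zero (mul_ne_zero hx ha.ne'), Real.sinc_of_ne_zero hx]
  have h : Real.sin (x * a) / (x * a) - Real.sin x / x
      = ((Real.sin (x * a) - Real.sin x) + (1 - a) * Real.sin x) / (x * a) := by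
    field_simp; ring
  have h1 : |Real.sin (x * a) - Real.sin x| ≤ (1 - a) * |x| := by
    have h2 := Real.abs_sin_sub_sin_le (x * a) x
    have h3 : x * a - x = -((1 - a) * x) := by ring
    rwa [h3, abs_neg, abs_mul, abs_of_nonneg (by linarith : 0 ≤ 1 - a)] at h2
  have h2 : |(1 - a) * Real.sin x| ≤ (1 - a) * |x| := by
    rw [abs_mul, abs_of_nonneg (by linarith : 0 ≤ 1 - a)]
    exact mul_le_mul_of_nonneg_left Real.abs_sin_le_abs (by linarith)
  rw [h, abs_div, abs_mul, abs_of_pos ha, div_le_div_iff₀ (by positivity) ha]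
  have h3 := abs_add_le (Real.sin (x * a) - Real.sin x) ((1 - a) * Real.sin x)
  nlinarith

lemma psiHat_eq (Ω : Set ℝ) {ε : ℝ} (h0 : 0 < ε) (h1 : ε < 1) (n : ℕ) (t : ℝ) :
    psiHat Ω ε n t =
      ∏' s : ℕ, Real.sinc (Real.pi * (t * volume.real Ω) * (1 - ε ^ n) * (ε ^ n) ^ s) := by
  unfold psiHat
  refine tprod_congr fun s => ?_
  have hn : 0 ≤ 1 - ε ^ n := by linarith [pow_le_one₀ h0.le h1.le (n := n)]
  rw [Measure.real, Measure.addHaar_smul, Measure.addHaar_smul, ENNReal.toReal_mul,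
    ENNReal.toReal_mul, ENNReal.toReal_ofReal (abs_nonneg _),
    ENNReal.toReal_ofReal (abs_nonneg _)]
  simp only [Module.finrank_self, pow_one]
  rw [abs_of_nonneg hn, abs_of_nonneg (by positivity), pow_mul, Measure.real]
  congr 1
  ring

lemma abs_tprod_sinc_sub_le {q : ℝ} (hq0 : 0 < q) (hq1 : q < 1) (x y : ℝ) (hxy : y = x * (1 - q)) :
    |∏' s : ℕ, Real.sinc (y * q ^ s) - Real.sinc x| ≤ q / (1 - q) + 2 * q / (1 - q) := by
  have hgeo : Summable fun s : ℕ => |y| * q ^ s :=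
    (summable_geometric_of_lt_one hq0.le hq1).mul_left _
  have hb : ∀ s, |Real.sinc (y * q ^ s) - 1| ≤ |y| * q ^ s := fun s => by
    refine (abs_sinc_sub_one_le _).trans_eq ?_
    rw [abs_mul, abs_of_pos (pow_pos hq0 s)]
  have hsum : Summable fun s : ℕ => |Real.sinc (y * q ^ s) - 1| :=
    Summable.of_nonneg_of_le (fun _ => abs_nonneg _) hb hgeo
  have hsum1 : Summable fun s : ℕ => ‖Real.sinc (y * q ^ (s + 1)) - 1‖ :=
    (summable_nat_add_iff (f := fun s : ℕ => |Real.sinc (y * q ^ s) - 1|) 1).mpr hsum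
  have hmul : Multipliable fun s : ℕ => Real.sinc (y * q ^ (s + 1)) := by
    have := multipliable_one_add_of_summable (R := ℝ)
      (f := fun s : ℕ => Real.sinc (y * q ^ (s + 1)) - 1)
      hsum1
    refine this.congr fun s => ?_
    ring
  have hsplit : ∏' s : ℕ, Real.sinc (y * q ^ s)
      = Real.sinc y * ∏' s : ℕ, Real.sinc (y * q ^ (s + 1)) := by
    have h0 := tprod_eq_zero_mul' (f := fun s : ℕ => Real.sinc (y * q ^ s)) hmul
    rwa [pow_zero, mul_one] at h0
  have hQ : |∏' s : ℕ, Real.sinc (y * q ^ (s + 1)) - 1| ≤ |y| * (q / (1 - q)) := by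
    have hlim := (hmul.hasProd.sub_const 1).abs
    refine le_of_tendsto hlim (Eventually.of_forall fun S => ?_)
    refine (abs_prod_sub_one_le _ (fun s => Real.abs_sinc_le_one _) S).trans ?_
    have hgeo' : Summable fun s : ℕ => |y| * q ^ (s + 1) := 
      (summable_nat_add_iff (f := fun s : ℕ => |y| * q ^ s) 1).mpr hgeo
    refine (Finset.sum_le_sum fun s _ => hb (s + 1)).trans ?_
    refine (hgeo'.sum_le_tsum S fun s _ => by positivity).trans_eq ?_
    rw [tsum_mul_left]
    congr 1
    simp_rw [pow_succ]
    rw [tsum_mul_right, tsum_geometric_of_lt_one hq0.le hq1]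
    ring
  have hy : |Real.sinc y| * |y| ≤ 1 := by
    rcases eq_or_ne y 0 with hy | hy
    · simp [hy]
    · rw [Real.sinc_of_ne_zero hy, ← abs_mul, div_mul_cancel₀ _ hy]
      exact Real.abs_sin_le_one y
  have hfirst : |Real.sinc y * ∏' s : ℕ, Real.sinc (y * q ^ (s + 1)) - Real.sinc y|
      ≤ q / (1 - q) := by
    rw [← mul_sub_one, abs_mul]
    calc _ ≤ |Real.sinc y| * (|y| * (q / (1 - q))) :=
          mul_le_mul_of_nonneg_left hQ (abs_nonneg _)
      _ = (|Real.sinc y| * |y|) * (q / (1 - q)) := by ring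
      _ ≤ q / (1 - q) := mul_le_of_le_one_left (div_nonneg hq0.le (by linarith)) hy
  have hsecond : |Real.sinc y - Real.sinc x| ≤ 2 * q / (1 - q) := by
    have := abs_sinc_mul_sub_sinc_le (a := 1 - q) (by linarith) (by linarith) x
    rw [hxy]
    simpa using this
  rw [hsplit]
  exact (abs_sub_le _ (Real.sinc y) _).trans (add_le_add hfirst hsecond)

lemma abs_psiHat_sub_le (Ω : Set ℝ) {ε : ℝ} (h0 : 0 < ε) (h1 : ε < 1) {n : ℕ} (hn : n ≠ 0)
    (t : ℝ) :
    |psiHat Ω ε n t - Real.sinc (Real.pi * (t * volume.real Ω))| ≤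
      ε ^ n / (1 - ε ^ n) + 2 * ε ^ n / (1 - ε ^ n) := by
  rw [psiHat_eq Ω h0 h1]
  exact abs_tprod_sinc_sub_le (pow_pos h0 n) (pow_lt_one₀ h0.le h1 hn) _ _ rfl

theorem tendstoUniformly_psiHat (Ω : Set ℝ) {ε : ℝ} (h0 : 0 < ε) (h1 : ε < 1) :
    TendstoUniformly (psiHat Ω ε) (Psi Ω ε) atTop := by
  have hp : Tendsto (fun n : ℕ => ε ^ n) atTop (𝓝 0) :=
    tendsto_pow_atTop_nhds_zero_of_lt_one h0.le h1
  have hlim : Tendsto (fun n : ℕ => ε ^ n / (1 - ε ^ n) + 2 * ε ^ n / (1 - ε ^ n))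
      atTop (𝓝 0) := by
    have hd : Tendsto (fun n : ℕ => 1 - ε ^ n) atTop (𝓝 (1 - 0)) := hp.const_sub 1
    have := (hp.div hd (by norm_num)).add ((hp.const_mul 2).div hd (by norm_num))
    simpa using this
  have hunif : TendstoUniformly (psiHat Ω ε)
      (fun t => Real.sinc (Real.pi * (t * volume.real Ω))) atTop := by
    rw [Metric.tendstoUniformly_iff]
    intro δ hδ
    filter_upwards [hlim.eventually_lt_const hδ, eventually_ne_atTop 0] with n hn hn0 t
    rw [dist_comm, Real.dist_eq]
    exact (abs_psiHat_sub_le Ω h0 h1 hn0 t).trans_lt hn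
  have hPsi : Psi Ω ε = fun t => Real.sinc (Real.pi * (t * volume.real Ω)) := by
    funext t
    exact (hunif.tendsto_at t).limUnder_eq
  rwa [hPsi]

/-! ### Gabor systems, Bessel sequences and duality -/

/-- A family `e` is a Bessel sequence: `∑ᵢ |⟨f, eᵢ⟩|² ≤ B ‖f‖²` for all `f`, for some `B > 0`. -/
def IsBessel {m : ℕ} {ι : Type*} (e : ι → L2 m) : Prop :=
  ∃ B : ℝ, 0 < B ∧ ∀ f : L2 m,
    Summable (fun i => ‖inner ℂ (e i) f‖ ^ 2) ∧ ∑' i, ‖inner ℂ (e i) f‖ ^ 2 ≤ B * ‖f‖ ^ 2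

/-- The family `d` is dual to the family `e`: `f = ∑ᵢ ⟨f, eᵢ⟩ dᵢ` in `L²` for every `f`. The
product `⟨f, g⟩`, linear in `f`, is `inner ℂ g f` in Mathlib. -/
def IsDualSystem {m : ℕ} {ι : Type*} (d e : ι → L2 m) : Prop :=
  ∀ f : L2 m, HasSum (fun i => inner ℂ (e i) f • d i) f

/-- The vector `B v ∈ ℝ^m` for a real matrix `B` and `v ∈ ℤ^m`. -/
def latticePoint {m : ℕ} (B : Matrix (Fin m) (Fin m) ℝ) (v : Fin m → ℤ) : Eucl m :=
  WithLp.toLp 2 (B.mulVec fun i => (v i : ℝ))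

/-- The Gabor system `{T_λ M_{An} g_l : l = 1, …, L, λ ∈ Λ, n ∈ ℤ^m}`. -/
def gaborSystem {m L : ℕ} (g : Fin L → L2 m) (Λ : Set (Eucl m)) (A : Matrix (Fin m) (Fin m) ℝ) :
    Fin L × Λ × (Fin m → ℤ) → L2 m :=
  fun i => translation (i.2.1 : Eucl m) (modulation (latticePoint A i.2.2) (g i.1))

end

end ModelSetGabor

open ModelSetGabor

/-!
The mixed frame operator `T` of the two Gabor systems exists by the Bessel assumptions, and duality
means `T = id`. For `f` and `f'` supported in cells of the lattice `A⁻ᵀℤ^m`, Parseval's identity on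
a cell carries out the sum over the frequencies `Aℤ^m` and gives
`⟨T T_{-x} f, T_{-x} f'⟩ = ∑_{λ ∈ Λ(Ω)} κ(λ + x)` for an explicit integrable kernel `κ`. The
right-hand side is the restriction to `ℝ^m × {0}` of the `Γ`-periodization of `1_Ω(s) κ(x)`. This
restriction is constant if and only if the periodization is almost everywhere constant, because
`p₂(Γ)` is dense and avoids the boundary of `Ω`; by uniqueness of Fourier coefficients this means
that the coefficients at all nonzero `η ∈ Γ*` vanish. Each coefficient is a Janssen coefficient
times `⟨f, T_{A⁻ᵀv} M_{p₁*(η)} f'⟩`, where `v` is the difference of the two cells, so constancy for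
all pairs of cells, with value `⟨f, f'⟩`, is the stated biorthogonality. The function `Φ` enters
because `Ψ` is a `sinc`, all factors with `s ≥ 1` tending to `1`, and `sinc * sinc = sinc`, which is
the Fourier transform of an interval.
-/

namespace ModelSetGabor

section FourierSeries

open Module ComplexConjugate

attribute [local instance] instMeasureSpaceUnitAddCircle

variable {ι E : Type*} [Fintype ι] [NormedAddCommGroup E] [NormedSpace ℝ E]

/-- The character `x ↦ exp(2πi ∑ nᵢ xᵢ)`, where the `xᵢ` are the coordinates of `x` in the
basis `b`. -/
noncomputable def basisChar (b : Basis ι ℝ E) (n : ι → ℤ) (x : E) : ℂ :=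
  Complex.exp (2 * Real.pi * Complex.I * ((∑ i, n i * b.repr x i : ℝ) : ℂ))

lemma norm_basisChar (b : Basis ι ℝ E) (n : ι → ℤ) (x : E) : ‖basisChar b n x‖ = 1 := by
  rw [basisChar, mul_right_comm, ← Complex.ofReal_ofNat, ← Complex.ofReal_mul,
    ← Complex.ofReal_mul, Complex.norm_exp_ofReal_mul_I]

lemma basisChar_add (b : Basis ι ℝ E) (n : ι → ℤ) (x y : E) :
    basisChar b n (x + y) = basisChar b n x * basisChar b n y := by
  simp only [basisChar, map_add, Finsupp.add_apply, mul_add, Finset.sum_add_distrib,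
    Complex.ofReal_add, Complex.exp_add]

/-- The parametrization of the fundamental domain of a basis, up to a null set, by the torus
`(ℝ/ℤ)^ι`. -/
noncomputable def torusToDomain (b : Basis ι ℝ E) (x : UnitAddTorus ι) : E :=
  b.equivFun.symm (UnitAddTorus.measurableEquivPiIoc (0 : ι → ℝ) x).1

lemma mFourier_eq_basisChar (b : Basis ι ℝ E) (n : ι → ℤ) (x : UnitAddTorus ι) :
    UnitAddTorus.mFourier n x = basisChar b n (torusToDomain b x) := by
  obtain ⟨y, rfl⟩ := (UnitAddTorus.measurableEquivPiIoc (0 : ι → ℝ)).symm.surjective x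
  have hrepr : ∀ i, b.repr (torusToDomain b
      ((UnitAddTorus.measurableEquivPiIoc (0 : ι → ℝ)).symm y)) i = y.1 i := fun i => by
    rw [torusToDomain, MeasurableEquiv.apply_symm_apply, ← b.equivFun_apply,
      LinearEquiv.apply_symm_apply]
  simp only [basisChar, hrepr]
  simp only [UnitAddTorus.mFourier, ContinuousMap.coe_mk,
    UnitAddTorus.coe_symm_measurableEquivPiIoc_apply, fourier_coe_apply]
  rw [← Complex.exp_sum, Complex.ofReal_sum, Finset.mul_sum]
  refine congrArg _ (Finset.sum_congr rfl fun i _ => ?_)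
  push_cast
  ring

omit [Fintype ι] in
lemma setOf_forall_mem_Ioc_eq_pi (a : ι → ℝ) :
    {x : ι → ℝ | ∀ i, x i ∈ Set.Ioc (a i) (a i + 1)} =
      Set.univ.pi fun i => Set.Ioc (a i) (a i + 1) := by
  ext x; simp

omit [Fintype ι] in
lemma measurableSet_forall_mem_Ioc [Finite ι] (a : ι → ℝ) :
    MeasurableSet {x : ι → ℝ | ∀ i, x i ∈ Set.Ioc (a i) (a i + 1)} := by
  rw [setOf_forall_mem_Ioc_eq_pi]
  exact MeasurableSet.univ_pi fun _ => measurableSet_Ioc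

lemma measurePreserving_coe_equivPiIoc :
    MeasurePreserving (fun x => (UnitAddTorus.measurableEquivPiIoc (0 : ι → ℝ) x).1) volume
      (volume.restrict (Set.univ.pi fun _ : ι => Set.Ico (0 : ℝ) 1)) := by
  have hval := measurePreserving_subtype_coe (μa := volume)
    (measurableSet_forall_mem_Ioc (0 : ι → ℝ))
  convert! hval.comp (UnitAddTorus.measurePreserving_equivPiIoc (0 : ι → ℝ)) using 1
  rw [setOf_forall_mem_Ioc_eq_pi]
  simp only [Pi.zero_apply, zero_add]
  exact Measure.restrict_congr_set
    (Measure.univ_pi_Ico_ae_eq_Icc.trans Measure.univ_pi_Ioc_ae_eq_Icc.symm)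

omit [Fintype ι] in
lemma preimage_equivFun_symm_fundamentalDomain [Finite ι] (b : Basis ι ℝ E) :
    b.equivFun.symm ⁻¹' ZSpan.fundamentalDomain b =
      Set.univ.pi fun _ : ι => Set.Ico (0 : ℝ) 1 := by
  ext x
  simp only [Set.mem_preimage, ZSpan.mem_fundamentalDomain, Set.mem_univ_pi, ← b.equivFun_apply,
    LinearEquiv.apply_symm_apply]

variable [MeasurableSpace E] [BorelSpace E]

omit [Fintype ι] in
lemma measurableEmbedding_equivFun_symm [Finite ι] (b : Basis ι ℝ E) :
    MeasurableEmbedding b.equivFun.symm :=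
  have := b.finiteDimensional_of_finite
  b.equivFun.symm.toContinuousLinearEquiv.toHomeomorph.measurableEmbedding

lemma measurableEmbedding_torusToDomain (b : Basis ι ℝ E) :
    MeasurableEmbedding (torusToDomain b) :=
  (measurableEmbedding_equivFun_symm b).comp
    ((MeasurableEmbedding.subtype_coe (measurableSet_forall_mem_Ioc 0)).comp
      (UnitAddTorus.measurableEquivPiIoc (0 : ι → ℝ)).measurableEmbedding)

section

variable (b : Basis ι ℝ E) (μ : Measure E) [μ.IsAddHaarMeasure]

omit [Fintype ι] [BorelSpace E] in
lemma measure_fundamentalDomain_ne_top [Finite ι] : μ (ZSpan.fundamentalDomain b) ≠ ∞ :=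
  have := b.finiteDimensional_of_finite
  (ZSpan.fundamentalDomain_isBounded b).measure_lt_top.ne

omit [Fintype ι] in
lemma measureReal_fundamentalDomain_pos [Finite ι] : 0 < μ.real (ZSpan.fundamentalDomain b) :=
  ENNReal.toReal_pos (ZSpan.measure_fundamentalDomain_ne_zero b)
    (measure_fundamentalDomain_ne_top b μ)

lemma map_equivFun_symm_volume :
    Measure.map b.equivFun.symm volume = (μ (ZSpan.fundamentalDomain b))⁻¹ • μ := by
  have := b.finiteDimensional_of_finite
  have : (Measure.map b.equivFun.symm (volume : Measure (ι → ℝ))).IsAddHaarMeasure :=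
    b.equivFun.symm.toContinuousLinearEquiv.isAddHaarMeasure_map volume
  have hone : Measure.map b.equivFun.symm volume (ZSpan.fundamentalDomain b) = 1 := by
    rw [(measurableEmbedding_equivFun_symm b).map_apply,
      preimage_equivFun_symm_fundamentalDomain, volume_pi_pi]
    simp
  have hscale := Measure.isAddLeftInvariant_eq_smul (Measure.map b.equivFun.symm volume) μ
  rw [hscale, Measure.smul_apply, ENNReal.smul_def, smul_eq_mul] at hone
  rw [hscale, ← ENNReal.eq_inv_of_mul_eq_one_left hone]
  rfl

lemma measurePreserving_torusToDomain :
    MeasurePreserving (torusToDomain b) volume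
      ((μ.restrict (ZSpan.fundamentalDomain b) Set.univ)⁻¹ •
        μ.restrict (ZSpan.fundamentalDomain b)) := by
  have hemb := measurableEmbedding_equivFun_symm b
  have hlin : MeasurePreserving b.equivFun.symm
      (volume.restrict (Set.univ.pi fun _ : ι => Set.Ico (0 : ℝ) 1))
      ((μ.restrict (ZSpan.fundamentalDomain b) Set.univ)⁻¹ •
        μ.restrict (ZSpan.fundamentalDomain b)) := by
    refine ⟨hemb.measurable, ?_⟩
    rw [← preimage_equivFun_symm_fundamentalDomain b, ← hemb.restrict_map,
      map_equivFun_symm_volume b μ, Measure.restrict_smul, Measure.restrict_apply_univ]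
  exact hlin.comp measurePreserving_coe_equivPiIoc

lemma integral_comp_torusToDomain (F : E → ℂ) :
    ∫ x, F (torusToDomain b x) = ⨍ x in ZSpan.fundamentalDomain b, F x ∂μ :=
  (measurePreserving_torusToDomain b μ).integral_comp (measurableEmbedding_torusToDomain b) F

lemma memLp_comp_torusToDomain {F : E → ℂ}
    (hF : MemLp F 2 (μ.restrict (ZSpan.fundamentalDomain b))) :
    MemLp (fun x => F (torusToDomain b x)) 2 volume := by
  refine (hF.smul_measure (ENNReal.inv_ne_top.2 ?_)).comp_measurePreserving
    (measurePreserving_torusToDomain b μ)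
  rw [Measure.restrict_apply_univ]
  exact ZSpan.measure_fundamentalDomain_ne_zero b

lemma mFourierCoeff_comp_torusToDomain {F : E → ℂ}
    (hF : MemLp (fun x => F (torusToDomain b x)) 2 volume) (n : ι → ℤ) :
    UnitAddTorus.mFourierCoeff (hF.toLp _) n =
      ⨍ x in ZSpan.fundamentalDomain b, F x * conj (basisChar b n x) ∂μ := by
  rw [← integral_comp_torusToDomain, UnitAddTorus.mFourierCoeff]
  refine integral_congr_ae ?_
  filter_upwards [hF.coeFn_toLp] with x hx
  rw [hx, UnitAddTorus.mFourier_neg, mFourier_eq_basisChar b, smul_eq_mul, mul_comm]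

theorem hasSum_fourier_fundamentalDomain {F H : E → ℂ}
    (hF : MemLp F 2 (μ.restrict (ZSpan.fundamentalDomain b)))
    (hH : MemLp H 2 (μ.restrict (ZSpan.fundamentalDomain b))) :
    HasSum (fun n : ι → ℤ =>
      (⨍ x in ZSpan.fundamentalDomain b, F x * conj (basisChar b n x) ∂μ) *
        conj (⨍ x in ZSpan.fundamentalDomain b, H x * conj (basisChar b n x) ∂μ))
      (⨍ x in ZSpan.fundamentalDomain b, F x * conj (H x) ∂μ) := by
  have hF' := memLp_comp_torusToDomain b μ hF
  have hH' := memLp_comp_torusToDomain b μ hH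
  have hparseval := UnitAddTorus.hasSum_prod_mFourierCoeff (hH'.toLp _) (hF'.toLp _)
  have hinner : ∫ t, conj ((hH'.toLp _) t) * (hF'.toLp _) t =
      ⨍ x in ZSpan.fundamentalDomain b, F x * conj (H x) ∂μ := by
    rw [← integral_comp_torusToDomain b μ (fun x => F x * conj (H x))]
    refine integral_congr_ae ?_
    filter_upwards [hF'.coeFn_toLp, hH'.coeFn_toLp] with x hx hy
    rw [hx, hy, mul_comm]
  simp only [mFourierCoeff_comp_torusToDomain b μ, hinner] at hparseval
  simpa only [mul_comm] using hparseval

theorem ae_eq_zero_of_fourier_eq_zero {F : E → ℂ}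
    (hF : MemLp F 2 (μ.restrict (ZSpan.fundamentalDomain b)))
    (h0 : ∀ n, ⨍ x in ZSpan.fundamentalDomain b, F x * conj (basisChar b n x) ∂μ = 0) :
    F =ᵐ[μ.restrict (ZSpan.fundamentalDomain b)] 0 := by
  have hparseval := hasSum_fourier_fundamentalDomain b μ hF hF
  simp only [h0, zero_mul] at hparseval
  have hsq : ∫ x in ZSpan.fundamentalDomain b, ‖F x‖ ^ 2 ∂μ = 0 := by
    have hav := hparseval.unique hasSum_zero
    simp only [Complex.mul_conj, Complex.normSq_eq_norm_sq, setAverage_eq] at hav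
    rw [integral_complex_ofReal, smul_eq_zero] at hav
    exact_mod_cast hav.resolve_left (inv_ne_zero (measureReal_fundamentalDomain_pos b μ).ne')
  rw [integral_eq_zero_iff_of_nonneg (fun x => by positivity)
    (hF.integrable_norm_pow two_ne_zero)] at hsq
  filter_upwards [hsq] with x hx
  simpa using hx

theorem average_conj_basisChar (n : ι → ℤ) :
    ⨍ x in ZSpan.fundamentalDomain b, conj (basisChar b n x) ∂μ = if n = 0 then 1 else 0 := by
  have horth := orthonormal_iff_ite.1 (UnitAddTorus.orthonormal_mFourier (d := ι)) n 0
  rw [ContinuousMap.inner_toLp] at horth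
  rw [← integral_comp_torusToDomain b μ (fun x => conj (basisChar b n x)), ← horth]
  refine integral_congr_ae (Eventually.of_forall fun x => ?_)
  simp [mFourier_eq_basisChar b, UnitAddTorus.mFourier_zero]

end

end FourierSeries

section Sinc

open FourierTransform Convolution

lemma intervalIntegral_exp_eq_sinc (t c d : ℝ) :
    ∫ x in c..d, Complex.exp (2 * Real.pi * Complex.I * ((t * x : ℝ) : ℂ)) =
      ((d - c : ℝ) : ℂ) * Complex.exp (Real.pi * Complex.I * ((t * (c + d) : ℝ) : ℂ)) *
        (Real.sinc (Real.pi * (t * (d - c))) : ℂ) := by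
  rcases eq_or_ne t 0 with rfl | ht
  · simp
  have hscale : 2 * Real.pi * t ≠ 0 := by positivity
  have hcentre : ∀ x : ℝ, Complex.exp (2 * Real.pi * Complex.I * ((t * x : ℝ) : ℂ)) =
      Complex.exp (Real.pi * Complex.I * ((t * (c + d) : ℝ) : ℂ)) *
        Complex.exp ((2 * Real.pi * t * x - Real.pi * t * (c + d) : ℝ) * Complex.I) := fun x => by
    rw [← Complex.exp_add]
    push_cast
    ring_nf
  have hleft : 2 * Real.pi * t * c - Real.pi * t * (c + d) = -(Real.pi * (t * (d - c))) := by ring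
  have hright : 2 * Real.pi * t * d - Real.pi * t * (c + d) = Real.pi * (t * (d - c)) := by ring
  simp only [hcentre]
  rw [intervalIntegral.integral_const_mul, intervalIntegral.integral_comp_mul_sub
    (fun x : ℝ => Complex.exp (x * Complex.I)) hscale, hleft, hright,
    integral_exp_mul_I_eq_sinc, Complex.real_smul]
  have htc : (t : ℂ) ≠ 0 := by exact_mod_cast ht
  have hpi : (Real.pi : ℂ) ≠ 0 := by exact_mod_cast Real.pi_ne_zero
  push_cast
  field_simp

lemma sq_sinc_le (x : ℝ) : Real.sinc x ^ 2 ≤ 2 * (1 + x ^ 2)⁻¹ := by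
  rcases eq_or_ne x 0 with rfl | hx
  · simp
  have hone : Real.sinc x ^ 2 ≤ 1 := (sq_le_one_iff_abs_le_one _).2 (Real.abs_sinc_le_one x)
  have hsin : Real.sinc x ^ 2 * x ^ 2 ≤ 1 := by
    rw [Real.sinc_of_ne_zero hx, ← mul_pow, div_mul_cancel₀ _ hx]
    exact Real.sin_sq_le_one x
  rw [← div_eq_mul_inv, le_div_iff₀ (by positivity)]
  linarith

lemma integrable_sinc_mul_sinc (t : ℝ) :
    Integrable fun u : ℝ => Real.sinc (Real.pi * u) * Real.sinc (Real.pi * (t - u)) := by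
  have hmeas : AEStronglyMeasurable (fun u : ℝ => Real.sinc (Real.pi * u)) volume := by fun_prop
  have hsq : MemLp (fun u : ℝ => Real.sinc (Real.pi * u)) 2 := by
    rw [memLp_two_iff_integrable_sq hmeas]
    refine Integrable.mono' ((integrable_inv_one_add_sq.const_mul 2).comp_mul_left'
      Real.pi_ne_zero) (hmeas.pow 2) (Eventually.of_forall fun u => ?_)
    rw [Real.norm_of_nonneg (sq_nonneg _)]
    exact sq_sinc_le _
  exact hsq.integrable_mul (hsq.comp_measurePreserving (volume.measurePreserving_sub_left t))

/-- The exponential `y ↦ exp(2πi t y)` cut off to the unit interval centred at the origin; its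
Fourier transform is a translate of `sinc`. -/
noncomputable def cutoffExp (t : ℝ) : ℝ → ℂ :=
  (Set.Ioc (-1 / 2) (1 / 2)).indicator fun y =>
    Complex.exp (2 * Real.pi * Complex.I * ((t * y : ℝ) : ℂ))

lemma integrable_cutoffExp (t : ℝ) : Integrable (cutoffExp t) :=
  (Continuous.integrableOn_Ioc (by fun_prop)).integrable_indicator measurableSet_Ioc

lemma integral_cutoffExp (t : ℝ) : ∫ y, cutoffExp t y = Real.sinc (Real.pi * t) := by
  have hexp := intervalIntegral_exp_eq_sinc t (-1 / 2) (1 / 2)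
  rw [intervalIntegral.integral_of_le (by norm_num)] at hexp
  rw [cutoffExp, integral_indicator measurableSet_Ioc, hexp]
  norm_num

lemma exp_mul_cutoffExp (s t y : ℝ) :
    Complex.exp (2 * Real.pi * Complex.I * ((s * y : ℝ) : ℂ)) * cutoffExp t y =
      cutoffExp (s + t) y := by
  by_cases hy : y ∈ Set.Ioc (-1 / 2 : ℝ) (1 / 2)
  · simp only [cutoffExp, Set.indicator_of_mem hy, ← Complex.exp_add, add_mul, Complex.ofReal_add,
      mul_add]
  · simp only [cutoffExp, Set.indicator_of_notMem hy, mul_zero]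

lemma fourier_cutoffExp (t u : ℝ) : 𝓕 (cutoffExp t) u = Real.sinc (Real.pi * (t - u)) := by
  rw [Real.fourier_eq', ← integral_cutoffExp]
  refine integral_congr_ae (Eventually.of_forall fun y => ?_)
  have hphase : Complex.exp (((-2 * Real.pi * inner ℝ y u : ℝ) : ℂ) * Complex.I) =
      Complex.exp (2 * Real.pi * Complex.I * ((-u * y : ℝ) : ℂ)) := by
    congr 1
    simp only [RCLike.inner_apply, conj_trivial]
    push_cast
    ring
  simp only [hphase, smul_eq_mul, exp_mul_cutoffExp, neg_add_eq_sub]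

lemma norm_cutoffExp_le_one (t y : ℝ) : ‖cutoffExp t y‖ ≤ 1 := by
  refine (norm_indicator_le_norm_self _ _).trans_eq ?_
  rw [mul_right_comm, ← Complex.ofReal_ofNat, ← Complex.ofReal_mul, ← Complex.ofReal_mul,
    Complex.norm_exp_ofReal_mul_I]

lemma ae_continuousAt_cutoffExp (t : ℝ) : ∀ᵐ y, ContinuousAt (cutoffExp t) (-y) := by
  have hfrontier : ∀ᵐ y : ℝ, y ≠ -1 / 2 ∧ y ≠ 1 / 2 :=
    (Measure.ae_ne volume _).and (Measure.ae_ne volume _)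
  filter_upwards [hfrontier] with y hy
  refine ContinuousOn.continuousAt_indicator (by fun_prop) fun hmem => ?_
  rw [frontier_Ioc (by norm_num)] at hmem
  rcases hmem with h | h
  · exact hy.2 (by linarith)
  · exact hy.1 (by linarith [Set.mem_singleton_iff.1 h])

lemma continuousAt_convolution_cutoffExp (s t : ℝ) :
    ContinuousAt (cutoffExp s ⋆[ContinuousLinearMap.mul ℂ ℂ] cutoffExp t) 0 := by
  refine continuousAt_of_dominated (bound := fun y => ‖cutoffExp s y‖)
    (Eventually.of_forall fun x => ?_) (Eventually.of_forall fun x => Eventually.of_forall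
      fun y => ?_) (integrable_cutoffExp s).norm ?_
  · exact ((integrable_cutoffExp s).1.mul
      ((integrable_cutoffExp t).1.comp_measurePreserving (volume.measurePreserving_sub_left x)))
  · rw [ContinuousLinearMap.mul_apply', norm_mul]
    exact mul_le_of_le_one_right (norm_nonneg _) (norm_cutoffExp_le_one t _)
  · filter_upwards [ae_continuousAt_cutoffExp t] with y hy
    simp only [ContinuousLinearMap.mul_apply']
    rw [← zero_sub] at hy
    exact continuousAt_const.mul
      (ContinuousAt.comp (f := fun x => x - y) hy (continuous_sub_right y).continuousAt)

lemma convolution_cutoffExp_zero (t : ℝ) :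
    (cutoffExp 0 ⋆[ContinuousLinearMap.mul ℂ ℂ] cutoffExp t) 0 = Real.sinc (Real.pi * t) := by
  rw [convolution_def, ← Real.sinc_neg, ← mul_neg, ← integral_cutoffExp]
  refine integral_congr_ae ?_
  filter_upwards [Measure.ae_ne volume (1 / 2 : ℝ)] with y hright
  by_cases hy : y ∈ Set.Ioc (-1 / 2 : ℝ) (1 / 2)
  · have hneg : 0 - y ∈ Set.Ioc (-1 / 2 : ℝ) (1 / 2) :=
      ⟨by linarith [lt_of_le_of_ne hy.2 hright], by linarith [hy.1]⟩
    simp only [cutoffExp, ContinuousLinearMap.mul_apply', Set.indicator_of_mem hy,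
      Set.indicator_of_mem hneg, ← Complex.exp_add]
    congr 1
    push_cast
    ring
  · simp only [cutoffExp, ContinuousLinearMap.mul_apply', Set.indicator_of_notMem hy, zero_mul]

theorem integral_sinc_mul_sinc (t : ℝ) :
    ∫ u : ℝ, Real.sinc (Real.pi * u) * Real.sinc (Real.pi * (t - u)) =
      Real.sinc (Real.pi * t) := by
  have hfourier : 𝓕 (cutoffExp 0 ⋆[ContinuousLinearMap.mul ℂ ℂ] cutoffExp t) =
      fun u => ((Real.sinc (Real.pi * u) * Real.sinc (Real.pi * (t - u)) : ℝ) : ℂ) := by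
    funext u
    rw [Real.fourier_mul_convolution_eq (integrable_cutoffExp 0) (integrable_cutoffExp t),
      fourier_cutoffExp, fourier_cutoffExp, zero_sub, mul_neg, Real.sinc_neg, Complex.ofReal_mul]
  have hinversion := ((integrable_cutoffExp 0).integrable_convolution
    (ContinuousLinearMap.mul ℂ ℂ) (integrable_cutoffExp t)).fourierInv_fourier_eq
    (hfourier ▸ (integrable_sinc_mul_sinc t).ofReal) (continuousAt_convolution_cutoffExp 0 t)
  rw [convolution_cutoffExp_zero, hfourier, Real.fourierInv_eq'] at hinversion
  simp only [inner_zero_right, mul_zero, Complex.ofReal_zero, zero_mul, Complex.exp_zero,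
    one_smul, integral_complex_ofReal] at hinversion
  exact_mod_cast hinversion

lemma Psi_eq_sinc (Ω : Set ℝ) {ε : ℝ} (hε0 : 0 < ε) (hε1 : ε < 1) (t : ℝ) :
    Psi Ω ε t = Real.sinc (Real.pi * (t * volume.real Ω)) := by
  have hpow : Tendsto (fun n : ℕ => ε ^ n) atTop (𝓝 0) :=
    tendsto_pow_atTop_nhds_zero_of_lt_one hε0.le hε1
  have hbound : Tendsto (fun n : ℕ => ε ^ n / (1 - ε ^ n) + 2 * ε ^ n / (1 - ε ^ n))
      atTop (𝓝 0) := by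
    have hdenom := hpow.const_sub 1
    simpa using (hpow.div hdenom (by norm_num)).add ((hpow.const_mul 2).div hdenom (by norm_num))
  refine tendsto_nhds_unique ((tendstoUniformly_psiHat Ω hε0 hε1).tendsto_at t)
    (tendsto_iff_norm_sub_tendsto_zero.2
      (squeeze_zero' (Eventually.of_forall fun _ => norm_nonneg _) ?_ hbound))
  filter_upwards [eventually_ne_atTop 0] with n hn
  exact abs_psiHat_sub_le Ω hε0 hε1 hn t

theorem Phi_eq_sinc {Ω : Set ℝ} (hΩ : 0 < volume.real Ω) {ε : ℝ} (hε0 : 0 < ε) (hε1 : ε < 1)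
    (t : ℝ) : Phi Ω ε t = Real.sinc (Real.pi * (t * volume.real Ω)) := by
  have hscale := Measure.integral_comp_mul_right (fun v =>
    Real.sinc (Real.pi * v) * Real.sinc (Real.pi * (t * volume.real Ω - v))) (volume.real Ω)
  rw [integral_sinc_mul_sinc, abs_of_pos (inv_pos.2 hΩ), smul_eq_mul] at hscale
  simp only [Phi, Psi_eq_sinc Ω hε0 hε1, sub_mul]
  rw [hscale, mul_inv_cancel_left₀ hΩ.ne']

end Sinc

section FundamentalDomain

variable {G α : Type*} [AddGroup G] [AddAction G α] [MeasurableSpace α] [Countable G]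
  [MeasurableConstVAdd G α] {μ : Measure α} [VAddInvariantMeasure G α μ] {D : Set α}

theorem integral_eq_setIntegral_tsum_vadd (hD : IsAddFundamentalDomain G D μ) {F : α → ℂ}
    (hF : Integrable F μ) : ∫ x, F x ∂μ = ∫ x in D, ∑' γ : G, F (γ +ᵥ x) ∂μ := by
  rw [hD.integral_eq_tsum'' F hF, integral_tsum]
  · exact fun γ => (hF.1.comp_measurePreserving (measurePreserving_vadd γ μ)).mono_measure
      Measure.restrict_le_self
  · rw [← hD.lintegral_eq_tsum'' fun x => ‖F x‖ₑ]
    exact hF.2.ne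

theorem measure_eq_setLIntegral_encard_vadd (hD : IsAddFundamentalDomain G D μ) {S : Set α}
    (hS : MeasurableSet S) : μ S = ∫⁻ x in D, ({γ : G | γ +ᵥ x ∈ S}.encard : ℝ≥0∞) ∂μ := by
  have hencard : ∀ x, ({γ : G | γ +ᵥ x ∈ S}.encard : ℝ≥0∞) =
      ∑' γ : G, S.indicator 1 (γ +ᵥ x) := fun x => by
    rw [← ENNReal.tsum_set_one]
    exact tsum_subtype {γ : G | γ +ᵥ x ∈ S} 1
  simp only [hencard]
  rw [lintegral_tsum, ← hD.lintegral_eq_tsum'', lintegral_indicator_one hS]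
  exact fun γ => ((measurable_one.indicator hS).comp (measurable_const_vadd γ)).aemeasurable

end FundamentalDomain

section LatticeDomain

open Module

instance isAddHaarMeasure_volume_prod (m : ℕ) :
    (volume : Measure (Eucl m × ℝ)).IsAddHaarMeasure :=
  inferInstanceAs ((volume : Measure (Eucl m)).prod (volume : Measure ℝ)).IsAddHaarMeasure

variable {m : ℕ} (Γ : Submodule ℤ (Eucl m × ℝ))

instance vaddInvariantMeasure_lattice : VAddInvariantMeasure Γ (Eucl m × ℝ) volume :=
  inferInstanceAs (VAddInvariantMeasure Γ.toAddSubgroup (Eucl m × ℝ) volume)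

instance measurableVAdd_lattice : MeasurableVAdd Γ (Eucl m × ℝ) :=
  inferInstanceAs (MeasurableVAdd Γ.toAddSubgroup (Eucl m × ℝ))

variable [DiscreteTopology Γ] [IsZLattice ℝ Γ]

/-- A real basis of `ℝ^m × ℝ` that is a `ℤ`-basis of the lattice `Γ`. -/
noncomputable def latticeBasis : Basis (Free.ChooseBasisIndex ℤ Γ) ℝ (Eucl m × ℝ) :=
  (Free.chooseBasis ℤ Γ).ofZLatticeBasis ℝ

/-- The fundamental parallelotope of the lattice `Γ` spanned by `latticeBasis Γ`. -/
noncomputable def latticeDomain : Set (Eucl m × ℝ) :=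
  ZSpan.fundamentalDomain (latticeBasis Γ)

lemma isAddFundamentalDomain_latticeDomain :
    IsAddFundamentalDomain Γ (latticeDomain Γ) volume :=
  ZLattice.isAddFundamentalDomain _ _

lemma volume_real_latticeDomain : volume.real (latticeDomain Γ) = ZLattice.covolume Γ :=
  (ZLattice.covolume_eq_measure_fundamentalDomain Γ volume
    (isAddFundamentalDomain_latticeDomain Γ)).symm

lemma volume_latticeDomain_ne_top : volume (latticeDomain Γ) ≠ ∞ :=
  measure_fundamentalDomain_ne_top _ _

lemma finite_inter_lattice {S : Set (Eucl m × ℝ)} (hS : Bornology.IsBounded S) :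
    (S ∩ (Γ : Set (Eucl m × ℝ))).Finite := by
  have hfinite := ZSpan.setFinite_inter (latticeBasis Γ) hS
  rwa [latticeBasis, Basis.ofZLatticeBasis_span] at hfinite

variable {Γ} {S S' : Set (Eucl m × ℝ)}

lemma volume_le_covolume_mul_ncard (hS : MeasurableSet S) (hS' : Bornology.IsBounded S')
    (hshift : ∀ z ∈ latticeDomain Γ, ∃ γ₀ : Γ, ∀ γ : Γ,
      (γ : Eucl m × ℝ) + z ∈ S → (γ + γ₀ : Eucl m × ℝ) ∈ S') :
    volume.real S ≤ ZLattice.covolume Γ * (S' ∩ (Γ : Set (Eucl m × ℝ))).ncard := by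
  have hfinite := finite_inter_lattice Γ hS'
  have hvolume : volume S ≤
      ((S' ∩ (Γ : Set (Eucl m × ℝ))).encard : ℝ≥0∞) * volume (latticeDomain Γ) := by
    rw [measure_eq_setLIntegral_encard_vadd (isAddFundamentalDomain_latticeDomain Γ) hS,
      ← setLIntegral_const]
    refine setLIntegral_mono' (ZSpan.fundamentalDomain_measurableSet _) fun z hz => ?_
    obtain ⟨γ₀, hγ₀⟩ := hshift z hz
    refine ENat.toENNReal_le.2 (Set.encard_le_encard_of_injOn
      (f := fun γ : Γ => (γ + γ₀ : Eucl m × ℝ)) (fun γ hγ => ⟨hγ₀ γ hγ, (γ + γ₀).2⟩) ?_)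
    exact fun γ _ γ' _ h => Subtype.ext (add_right_cancel h)
  rw [← hfinite.cast_ncard_eq] at hvolume
  have hreal := ENNReal.toReal_mono
    (ENNReal.mul_ne_top (by simp) (volume_latticeDomain_ne_top Γ)) hvolume
  rw [← volume_real_latticeDomain, mul_comm]
  simpa [measureReal_def] using hreal

lemma covolume_mul_ncard_le_volume (hS : MeasurableSet S) (hS' : Bornology.IsBounded S)
    (hshift : ∀ z ∈ latticeDomain Γ, ∃ γ₀ : Γ, ∀ γ : Γ,
      (γ + γ₀ : Eucl m × ℝ) ∈ S' → (γ : Eucl m × ℝ) + z ∈ S) :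
    ZLattice.covolume Γ * (S' ∩ (Γ : Set (Eucl m × ℝ))).ncard ≤ volume.real S := by
  have hvolume : ((S' ∩ (Γ : Set (Eucl m × ℝ))).ncard : ℝ≥0∞) * volume (latticeDomain Γ) ≤
      volume S := by
    rw [measure_eq_setLIntegral_encard_vadd (isAddFundamentalDomain_latticeDomain Γ) hS,
      ← setLIntegral_const]
    refine setLIntegral_mono' (ZSpan.fundamentalDomain_measurableSet _) fun z hz => ?_
    obtain ⟨γ₀, hγ₀⟩ := hshift z hz
    rw [← ENat.toENNReal_coe]
    refine ENat.toENNReal_le.2 ((Set.ncard_le_encard _).trans ?_)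
    rw [← Set.encard_preimage_of_injective_subset_range (f := fun γ : Γ => (γ + γ₀ : Eucl m × ℝ))
      (fun γ γ' h => Subtype.ext (add_right_cancel h))]
    · exact Set.encard_le_encard fun γ hγ => hγ₀ γ hγ.1
    · exact fun γ hγ => ⟨⟨γ, hγ.2⟩ - γ₀, by simp⟩
  have hreal := ENNReal.toReal_mono hS'.measure_lt_top.ne hvolume
  rw [← volume_real_latticeDomain, mul_comm]
  simpa [measureReal_def] using hreal

end LatticeDomain

section Density

variable {m : ℕ}

lemma cube_eq_preimage (x : Eucl m) (R : ℝ) :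
    cube x R = WithLp.ofLp ⁻¹' Set.univ.pi fun i => Set.Icc (x i) (x i + R) := by
  ext t
  simp [cube, -Set.pi_univ_Icc]

lemma isCompact_cube (x : Eucl m) (R : ℝ) : IsCompact (cube x R) := by
  rw [cube_eq_preimage]
  exact (PiLp.homeomorph 2 fun _ : Fin m => ℝ).isCompact_preimage.2
    (isCompact_univ_pi fun _ => isCompact_Icc)

lemma volume_real_cube (x : Eucl m) {R : ℝ} (hR : 0 ≤ R) : volume.real (cube x R) = R ^ m := by
  rw [cube_eq_preimage, measureReal_def, (PiLp.volume_preserving_ofLp (Fin m)).measure_preimage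
    (MeasurableSet.univ_pi fun _ => measurableSet_Icc).nullMeasurableSet, volume_pi_pi]
  simp [hR]

lemma mem_cube_of_norm_sub_le {x y y' : Eucl m} {R C : ℝ} (hy : y ∈ cube x R)
    (hyy' : ‖y' - y‖ ≤ C) : y' ∈ cube (x - WithLp.toLp 2 fun _ => C) (R + 2 * C) := by
  intro i
  have hi := abs_le.1 ((PiLp.norm_apply_le (y' - y) i).trans hyy')
  have hyi := hy i
  simp only [PiLp.sub_apply] at hi ⊢
  constructor <;> linarith

lemma exists_thickening_approx {X : Type*} [MetricSpace X] [ProperSpace X] [MeasurableSpace X]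
    [BorelSpace X] (μ : Measure X) [IsFiniteMeasureOnCompacts μ] {Ω : Set X}
    (hbounded : Bornology.IsBounded Ω) (hfrontier : μ (frontier Ω) = 0) {ε : ℝ} (hε : 0 < ε) :
    ∃ δ > 0, μ.real (Metric.cthickening δ Ω) < μ.real Ω + ε ∧
      μ.real Ω - ε < μ.real (Metric.cthickening δ Ωᶜ)ᶜ := by
  have houter : Tendsto (fun δ => μ.real (Metric.cthickening δ Ω)) (𝓝 0) (𝓝 (μ.real Ω)) := by
    rw [measureReal_def, ← measure_closure_of_null_frontier hfrontier]
    exact (ENNReal.tendsto_toReal hbounded.closure.measure_lt_top.ne).comp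
      (tendsto_measure_cthickening ⟨1, one_pos, hbounded.cthickening.measure_lt_top.ne⟩)
  have hinterior : μ (interior Ω) ≠ ∞ :=
    (hbounded.subset interior_subset).measure_lt_top.ne
  have hinner : Tendsto (fun δ => (μ.restrict (interior Ω)).real (Metric.cthickening δ Ωᶜ))
      (𝓝 0) (𝓝 0) := by
    have hlimit := tendsto_measure_cthickening (μ := μ.restrict (interior Ω)) (s := Ωᶜ)
      ⟨1, one_pos,
        ne_top_of_le_ne_top (by simpa using hinterior) (measure_mono (Set.subset_univ _))⟩
    rw [closure_compl, Measure.restrict_apply isOpen_interior.measurableSet.compl,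
      Set.compl_inter_self, measure_empty] at hlimit
    exact (ENNReal.tendsto_toReal ENNReal.zero_ne_top).comp hlimit
  have hsmall := (houter.eventually_lt_const (lt_add_of_pos_right _ hε)).and
    (hinner.eventually_lt_const hε)
  obtain ⟨δ, ⟨houterδ, hinnerδ⟩, hδ⟩ :=
    ((hsmall.filter_mono nhdsWithin_le_nhds).and (self_mem_nhdsWithin (s := Set.Ioi 0))).exists
  refine ⟨δ, hδ, houterδ, ?_⟩
  have hthick : MeasurableSet (Metric.cthickening δ Ωᶜ) := Metric.isClosed_cthickening.measurableSet
  have hsplit := measureReal_inter_add_sdiff (μ := μ) (s := interior Ω) hthick hinterior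
  rw [measureReal_restrict_apply hthick, Set.inter_comm] at hinnerδ
  have hΩ : μ.real (interior Ω) = μ.real Ω := by
    rw [measureReal_def, measure_interior_of_null_frontier hfrontier, measureReal_def]
  have hsubset : (Metric.cthickening δ Ωᶜ)ᶜ ⊆ Ω :=
    Set.compl_subset_comm.1 (Metric.self_subset_cthickening _)
  have hmono : μ.real (interior Ω \ Metric.cthickening δ Ωᶜ) ≤
      μ.real (Metric.cthickening δ Ωᶜ)ᶜ :=
    measureReal_mono (fun _ h => h.2) (hbounded.subset hsubset).measure_lt_top.ne
  linarith

section Counting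

variable {Γ : Submodule ℤ (Eucl m × ℝ)} {Ω : Set ℝ}

lemma modelSet_inter_cube (x : Eucl m) (R : ℝ) :
    modelSet Γ Ω ∩ cube x R = Prod.fst '' (cube x R ×ˢ Ω ∩ (Γ : Set (Eucl m × ℝ))) := by
  ext y
  constructor
  · rintro ⟨⟨γ, hγ, hsnd, rfl⟩, hfst⟩
    exact ⟨γ, ⟨⟨hfst, hsnd⟩, hγ⟩, rfl⟩
  · rintro ⟨γ, ⟨⟨hfst, hsnd⟩, hγ⟩, rfl⟩
    exact ⟨⟨γ, hγ, hsnd, rfl⟩, hfst⟩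

lemma ncard_modelSet_inter_cube (hinj : Set.InjOn Prod.fst (Γ : Set (Eucl m × ℝ)))
    (x : Eucl m) (R : ℝ) :
    (modelSet Γ Ω ∩ cube x R).ncard = (cube x R ×ˢ Ω ∩ (Γ : Set (Eucl m × ℝ))).ncard := by
  rw [modelSet_inter_cube, (hinj.mono Set.inter_subset_right).ncard_image]

lemma exists_lattice_approx (hdense : Dense (Prod.snd '' (Γ : Set (Eucl m × ℝ))))
    {D : Set (Eucl m × ℝ)} (hD : Bornology.IsBounded D) {δ : ℝ} (hδ : 0 < δ) :
    ∃ C, 0 ≤ C ∧ ∀ z ∈ D, ∃ γ : Γ, ‖(γ : Eucl m × ℝ).1 - z.1‖ ≤ C ∧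
      |(γ : Eucl m × ℝ).2 - z.2| ≤ δ := by
  obtain ⟨M, hM⟩ := hD.exists_norm_le
  have hcover : Metric.closedBall (0 : ℝ) M ⊆ ⋃ γ : Γ, Metric.ball (γ : Eucl m × ℝ).2 δ := by
    intro s _
    obtain ⟨_, ⟨γ, hγ, rfl⟩, hdist⟩ := hdense.exists_dist_lt s hδ
    exact Set.mem_iUnion.2 ⟨⟨γ, hγ⟩, hdist⟩
  obtain ⟨S, hS⟩ := (isCompact_closedBall (0 : ℝ) M).elim_finite_subcover _
    (fun _ => Metric.isOpen_ball) hcover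
  refine ⟨∑ γ ∈ S, ‖(γ : Eucl m × ℝ).1‖ + |M|, by positivity, fun z hz => ?_⟩
  have hzM : ‖z‖ ≤ M := hM z hz
  obtain ⟨γ, hγ, hdist⟩ := Set.mem_iUnion₂.1
    (hS (mem_closedBall_zero_iff.2 ((norm_snd_le z).trans hzM)))
  refine ⟨γ, (norm_sub_le _ _).trans (add_le_add ?_ ?_), ?_⟩
  · exact Finset.single_le_sum (f := fun γ : Γ => ‖(γ : Eucl m × ℝ).1‖)
      (fun _ _ => norm_nonneg _) hγ
  · exact (norm_fst_le z).trans (hzM.trans (le_abs_self M))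
  · rw [Metric.mem_ball', Real.dist_eq] at hdist
    exact hdist.le

variable [DiscreteTopology Γ] [IsZLattice ℝ Γ]

lemma exists_ncard_modelSet_bounds (hinj : Set.InjOn Prod.fst (Γ : Set (Eucl m × ℝ)))
    (hdense : Dense (Prod.snd '' (Γ : Set (Eucl m × ℝ)))) (hΩ : Bornology.IsBounded Ω)
    {δ : ℝ} (hδ : 0 < δ) : ∃ C, 0 ≤ C ∧ ∀ (x : Eucl m) (R : ℝ), C ≤ R →
      (R - C) ^ m * volume.real (Metric.cthickening δ Ωᶜ)ᶜ ≤
        ZLattice.covolume Γ * (modelSet Γ Ω ∩ cube x R).ncard ∧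
      ZLattice.covolume Γ * (modelSet Γ Ω ∩ cube x R).ncard ≤
        (R + C) ^ m * volume.real (Metric.cthickening δ Ω) := by
  obtain ⟨C, hC, hshift⟩ := exists_lattice_approx hdense
    (ZSpan.fundamentalDomain_isBounded (latticeBasis Γ)) hδ
  let c : Eucl m := WithLp.toLp 2 fun _ => C
  refine ⟨2 * C, by positivity, fun x R hR => ?_⟩
  rw [ncard_modelSet_inter_cube hinj]
  constructor
  · rw [← volume_real_cube (x + c) (sub_nonneg.2 hR), ← measureReal_prod_prod]
    refine volume_le_covolume_mul_ncard
      ((isCompact_cube _ _).measurableSet.prod Metric.isClosed_cthickening.measurableSet.compl)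
      ((isCompact_cube x R).isBounded.prod hΩ) fun z hz => ?_
    obtain ⟨γ₀, hfst, hsnd⟩ := hshift z hz
    refine ⟨γ₀, fun γ hγ => ⟨?_, ?_⟩⟩
    · have hmem := mem_cube_of_norm_sub_le (y' := (γ + γ₀ : Eucl m × ℝ).1) hγ.1
        (by simpa using hfst)
      rwa [add_sub_cancel_right, sub_add_cancel] at hmem
    · by_contra hnot
      refine hγ.2 (Metric.mem_cthickening_of_dist_le _ _ _ _ hnot ?_)
      rw [dist_comm, Real.dist_eq]
      simpa using hsnd
  · rw [← volume_real_cube (x - c) (add_nonneg (hC.trans (by linarith)) (by positivity)),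
      ← measureReal_prod_prod]
    refine covolume_mul_ncard_le_volume
      ((isCompact_cube _ _).measurableSet.prod Metric.isClosed_cthickening.measurableSet)
      ((isCompact_cube _ _).isBounded.prod hΩ.cthickening) fun z hz => ?_
    obtain ⟨γ₀, hfst, hsnd⟩ := hshift z hz
    refine ⟨γ₀, fun γ hγ => ⟨mem_cube_of_norm_sub_le hγ.1 ?_, ?_⟩⟩
    · rw [norm_sub_rev]
      simpa using hfst
    · refine Metric.mem_cthickening_of_dist_le _ _ _ _ hγ.2 ?_
      rw [dist_comm, Real.dist_eq]
      simpa using hsnd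

lemma tendsto_add_div_pow (C : ℝ) (k : ℕ) :
    Tendsto (fun R : ℝ => ((R + C) / R) ^ k) atTop (𝓝 1) := by
  have hlimit : Tendsto (fun R : ℝ => (1 + C / R) ^ k) atTop (𝓝 1) := by
    simpa using ((tendsto_const_nhds.div_atTop tendsto_id).const_add (1 : ℝ)).pow k
  refine hlimit.congr' ?_
  filter_upwards [eventually_ne_atTop 0] with R hR
  rw [add_div, div_self hR]

theorem hasDensity_modelSet (hinj : Set.InjOn Prod.fst (Γ : Set (Eucl m × ℝ)))
    (hdense : Dense (Prod.snd '' (Γ : Set (Eucl m × ℝ)))) (hbounded : Bornology.IsBounded Ω)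
    (hfrontier : volume (frontier Ω) = 0) :
    HasDensity (modelSet Γ Ω) (volume.real Ω / ZLattice.covolume Γ) := by
  have hcovol : 0 < ZLattice.covolume Γ := ZLattice.covolume_pos Γ volume
  refine ⟨fun x R => ?_, fun x => tendsto_order.2 ⟨fun d hd => ?_, fun d hd => ?_⟩⟩
  · rw [modelSet_inter_cube]
    exact (finite_inter_lattice Γ ((isCompact_cube x R).isBounded.prod hbounded)).image _
  · rw [lt_div_iff₀ hcovol] at hd
    obtain ⟨δ, hδ, -, hinner⟩ := exists_thickening_approx volume hbounded hfrontier (sub_pos.2 hd)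
    obtain ⟨C, -, hC⟩ := exists_ncard_modelSet_bounds hinj hdense hbounded hδ
    have hlimit := (tendsto_add_div_pow (-C) m).mul_const
      (volume.real (Metric.cthickening δ Ωᶜ)ᶜ)
    rw [one_mul] at hlimit
    rw [sub_sub_cancel] at hinner
    filter_upwards [hlimit.eventually_const_lt hinner, eventually_gt_atTop 0,
      eventually_ge_atTop C] with R hlt hR hCR
    rw [div_pow, div_mul_eq_mul_div, lt_div_iff₀ (by positivity), ← sub_eq_add_neg] at hlt
    rw [lt_div_iff₀ (by positivity), ← mul_lt_mul_iff_right₀ hcovol]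
    linarith [(hC x R hCR).1]
  · rw [gt_iff_lt, div_lt_iff₀ hcovol] at hd
    obtain ⟨δ, hδ, houter, -⟩ := exists_thickening_approx volume hbounded hfrontier (sub_pos.2 hd)
    obtain ⟨C, -, hC⟩ := exists_ncard_modelSet_bounds hinj hdense hbounded hδ
    have hlimit := (tendsto_add_div_pow C m).mul_const (volume.real (Metric.cthickening δ Ω))
    rw [one_mul] at hlimit
    rw [add_sub_cancel] at houter
    filter_upwards [hlimit.eventually_lt_const houter, eventually_gt_atTop 0,
      eventually_ge_atTop C] with R hlt hR hCR
    rw [div_pow, div_mul_eq_mul_div, div_lt_iff₀ (by positivity)] at hlt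
    rw [div_lt_iff₀ (by positivity), ← mul_lt_mul_iff_right₀ hcovol]
    linarith [(hC x R hCR).2]

end Counting

end Density

section FrameOperator

variable {m : ℕ} {ι : Type*} {e d : ι → L2 m}

lemma IsBessel.exists_analysis (he : IsBessel e) :
    ∃ C : L2 m →L[ℂ] lp (fun _ : ι => ℂ) 2, ∀ f i, C f i = inner ℂ (e i) f := by
  obtain ⟨B, hB, hbound⟩ := he
  have hmem : ∀ f : L2 m, Memℓp (fun i => inner ℂ (e i) f : ι → ℂ) 2 := fun f =>
    memℓp_gen (by simpa using (hbound f).1)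
  let C : L2 m →ₗ[ℂ] lp (fun _ : ι => ℂ) 2 :=
    { toFun := fun f => ⟨fun i => inner ℂ (e i) f, hmem f⟩
      map_add' := fun f g => by ext i; exact inner_add_right _ _ _
      map_smul' := fun c f => by ext i; exact inner_smul_right _ _ _ }
  refine ⟨C.mkContinuous (Real.sqrt B) fun f => ?_, fun f i => rfl⟩
  have hnorm : ‖C f‖ ^ 2 = ∑' i, ‖inner ℂ (e i) f‖ ^ 2 := by
    have hpow := lp.norm_rpow_eq_tsum (p := 2) (by simp) (C f)
    rw [ENNReal.toReal_ofNat] at hpow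
    exact_mod_cast hpow
  refine le_of_sq_le_sq ?_ (by positivity)
  rw [hnorm, mul_pow, Real.sq_sqrt hB.le]
  exact (hbound f).2

theorem IsBessel.exists_frameOperator (he : IsBessel e) (hd : IsBessel d) :
    ∃ T : L2 m →L[ℂ] L2 m, ∀ f, HasSum (fun i => inner ℂ (e i) f • d i) (T f) := by
  classical
  obtain ⟨Ce, hCe⟩ := he.exists_analysis
  obtain ⟨Cd, hCd⟩ := hd.exists_analysis
  have adjoint_single : ∀ i (c : ℂ), Cd.adjoint (lp.single 2 i c) = c • d i := by
    refine fun i c => ext_inner_left ℂ fun v => ?_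
    rw [ContinuousLinearMap.adjoint_inner_right, lp.inner_single_right, hCd, inner_smul_right,
      RCLike.inner_apply, inner_conj_symm]
  refine ⟨Cd.adjoint.comp Ce, fun f => ?_⟩
  have hsum := Cd.adjoint.hasSum
    (lp.hasSum_single (E := fun _ : ι => ℂ) (p := 2) (by simp) (Ce f))
  simp only [adjoint_single, hCe] at hsum
  exact hsum

variable {T : L2 m →L[ℂ] L2 m}

lemma isDualSystem_iff_eq_id (hT : ∀ f, HasSum (fun i => inner ℂ (e i) f • d i) (T f)) :
    IsDualSystem d e ↔ T = ContinuousLinearMap.id ℂ (L2 m) :=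
  ⟨fun hdual => ContinuousLinearMap.ext fun f => (hT f).unique (hdual f),
    fun hid f => by simpa [hid] using hT f⟩

lemma hasSum_inner_frameOperator (hT : ∀ f, HasSum (fun i => inner ℂ (e i) f • d i) (T f))
    (f f' : L2 m) :
    HasSum (fun i => inner ℂ (e i) f * inner ℂ f' (d i)) (inner ℂ f' (T f)) := by
  simpa only [map_smul, innerSL_apply_apply, smul_eq_mul] using (innerSL ℂ f').hasSum (hT f)

end FrameOperator

section TotalSet

variable {E : Type*} [NormedAddCommGroup E] [InnerProductSpace ℂ E] [CompleteSpace E]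

lemma eq_id_of_inner_eq {T : E →L[ℂ] E} {S : Set E}
    (hS : ∀ f, (∀ g ∈ S, inner ℂ g f = 0) → f = 0)
    (hT : ∀ f ∈ S, ∀ g ∈ S, inner ℂ g (T f) = inner ℂ g f) :
    T = ContinuousLinearMap.id ℂ E := by
  have hfix : ∀ f ∈ S, T f = f := fun f hf =>
    sub_eq_zero.1 (hS _ fun g hg => by rw [inner_sub_right, hT f hf g hg, sub_self])
  have hdense : Dense (Submodule.span ℂ S : Set E) := by
    rw [Submodule.dense_iff_topologicalClosure_eq_top, Submodule.topologicalClosure_eq_top_iff,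
      Submodule.eq_bot_iff]
    exact fun f hf =>
      hS f fun g hg => (Submodule.mem_orthogonal _ f).1 hf g (Submodule.subset_span hg)
  exact ContinuousLinearMap.ext_on hdense fun f hf => by simpa using hfix f hf

end TotalSet

section FourierUniqueness

open Module ComplexConjugate

variable {ι E : Type*} [Fintype ι] [NormedAddCommGroup E] [NormedSpace ℝ E] (b : Basis ι ℝ E)

lemma continuous_basisChar (n : ι → ℤ) : Continuous (basisChar b n) := by
  have := b.finiteDimensional_of_finite
  have hcoord : ∀ i, Continuous fun x => b.repr x i := fun i =>
    LinearMap.continuous_of_finiteDimensional (b.coord i)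
  unfold basisChar
  fun_prop

variable [MeasurableSpace E] [BorelSpace E] (μ : Measure E) [μ.IsAddHaarMeasure]

lemma ae_eq_const_of_fourier {F : E → ℂ} {c : ℂ}
    (hF : MemLp F 2 (μ.restrict (ZSpan.fundamentalDomain b)))
    (hcoeff : ∀ n, ⨍ x in ZSpan.fundamentalDomain b, F x * conj (basisChar b n x) ∂μ =
      if n = 0 then c else 0) :
    ∀ᵐ x ∂μ.restrict (ZSpan.fundamentalDomain b), F x = c := by
  have : IsFiniteMeasure (μ.restrict (ZSpan.fundamentalDomain b)) :=
    isFiniteMeasure_restrict.2 (measure_fundamentalDomain_ne_top b μ)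
  have integrable_mul_conj : ∀ {G : E → ℂ} n,
      Integrable G (μ.restrict (ZSpan.fundamentalDomain b)) →
      Integrable (fun x => G x * conj (basisChar b n x))
        (μ.restrict (ZSpan.fundamentalDomain b)) := fun n hG =>
    hG.mul_bdd (c := 1)
      (Complex.continuous_conj.comp (continuous_basisChar b n)).aestronglyMeasurable
      (Eventually.of_forall fun x => by rw [RCLike.norm_conj, norm_basisChar])
  have hzero := ae_eq_zero_of_fourier_eq_zero b μ (hF.sub (memLp_const c)) fun n => by
    have hconst : ⨍ x in ZSpan.fundamentalDomain b, c * conj (basisChar b n x) ∂μ =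
        if n = 0 then c else 0 := by
      rw [average, integral_const_mul]
      exact (congrArg (c * ·) (average_conj_basisChar b μ n)).trans (by simp)
    simp only [Pi.sub_apply, sub_mul]
    rw [setAverage_eq] at hconst ⊢
    rw [integral_sub (integrable_mul_conj n (hF.integrable one_le_two))
      (integrable_mul_conj n (integrable_const c)), smul_sub, hconst, ← setAverage_eq, hcoeff,
      sub_self]
  filter_upwards [hzero] with x hx using sub_eq_zero.1 hx

end FourierUniqueness

section DualLattice

open Module ComplexConjugate

variable {m : ℕ}

/-- The Euclidean inner product of `ℝ^m × ℝ` as a bilinear form; the product type `Eucl m × ℝ`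
itself carries the sup norm. -/
noncomputable def dotForm (m : ℕ) : LinearMap.BilinForm ℝ (Eucl m × ℝ) :=
  (innerₗ (Eucl m)).compl₁₂ (LinearMap.fst ℝ _ _) (LinearMap.fst ℝ _ _) +
    (LinearMap.mul ℝ ℝ).compl₁₂ (LinearMap.snd ℝ _ _) (LinearMap.snd ℝ _ _)

lemma dotForm_apply (η z : Eucl m × ℝ) : dotForm m η z = inner ℝ η.1 z.1 + η.2 * z.2 :=
  rfl

lemma isSymm_dotForm : (dotForm m).IsSymm :=
  ⟨fun η z => by
    simp only [dotForm_apply, real_inner_comm, mul_comm]⟩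

lemma nondegenerate_dotForm : (dotForm m).Nondegenerate := by
  refine (LinearMap.BilinForm.IsSymm.isRefl isSymm_dotForm).nondegenerate_iff_separatingLeft.2
    fun η hη => ?_
  have hself : ‖η.1‖ ^ 2 + η.2 ^ 2 = 0 := by
    rw [← real_inner_self_eq_norm_sq, sq η.2]
    exact hη η
  obtain ⟨hfst, hsnd⟩ := (add_eq_zero_iff_of_nonneg (sq_nonneg _) (sq_nonneg _)).1 hself
  exact Prod.ext (by simpa using hfst) (by simpa using hsnd)

/-- The character `z ↦ exp(2πi η·z)` of `ℝ^m × ℝ`. -/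
noncomputable def prodChar (η z : Eucl m × ℝ) : ℂ :=
  Complex.exp (2 * Real.pi * Complex.I * (dotForm m η z : ℂ))

lemma prodChar_eq_mul (η z : Eucl m × ℝ) : prodChar η z = character η.1 z.1 *
    Complex.exp (2 * Real.pi * Complex.I * ((η.2 * z.2 : ℝ) : ℂ)) := by
  rw [prodChar, character, ← Complex.exp_add, ← mul_add, ← Complex.ofReal_add, dotForm_apply]

lemma norm_prodChar (η z : Eucl m × ℝ) : ‖prodChar η z‖ = 1 := by
  rw [prodChar, mul_right_comm, ← Complex.ofReal_ofNat, ← Complex.ofReal_mul,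
    ← Complex.ofReal_mul, Complex.norm_exp_ofReal_mul_I]

lemma continuous_prodChar (η : Eucl m × ℝ) : Continuous (prodChar η) := by
  unfold prodChar
  simp only [dotForm_apply]
  fun_prop

variable {Γ : Submodule ℤ (Eucl m × ℝ)}

lemma dualLattice_eq_dualSubmodule : dualLattice Γ = (dotForm m).dualSubmodule Γ := by
  ext η
  refine forall₂_congr fun γ _ => ?_
  rw [Submodule.mem_one, dotForm_apply, real_inner_comm, mul_comm]
  simp only [eq_intCast, eq_comm]

lemma prodChar_add_of_mem {η γ : Eucl m × ℝ} (hη : η ∈ dualLattice Γ) (hγ : γ ∈ Γ)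
    (z : Eucl m × ℝ) : prodChar η (γ + z) = prodChar η z := by
  rw [dualLattice_eq_dualSubmodule] at hη
  obtain ⟨k, hk⟩ := Submodule.mem_one.1 (hη γ hγ)
  rw [prodChar, prodChar, map_add, ← hk,
    ← Complex.exp_periodic.int_mul k (2 * Real.pi * Complex.I * (dotForm m η z : ℂ))]
  congr 1
  push_cast [eq_intCast]
  ring

variable [DiscreteTopology Γ] [IsZLattice ℝ Γ]

variable (Γ) in
/-- The basis of the dual lattice that is dual to `latticeBasis Γ`. -/
noncomputable def dualLatticeBasis : Basis (Free.ChooseBasisIndex ℤ Γ) ℝ (Eucl m × ℝ) :=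
  (dotForm m).dualBasis nondegenerate_dotForm (latticeBasis Γ)

lemma mem_dualLattice_iff {η : Eucl m × ℝ} :
    η ∈ dualLattice Γ ↔
      ∃ n : Free.ChooseBasisIndex ℤ Γ → ℤ, ∑ i, n i • dualLatticeBasis Γ i = η := by
  classical
  rw [← Submodule.mem_span_range_iff_exists_fun, dualLatticeBasis,
    ← LinearMap.BilinForm.dualSubmodule_span_of_basis, latticeBasis, Basis.ofZLatticeBasis_span,
    dualLattice_eq_dualSubmodule]

lemma sum_dualLatticeBasis_eq_zero_iff (n : Free.ChooseBasisIndex ℤ Γ → ℤ) :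
    ∑ i, n i • dualLatticeBasis Γ i = 0 ↔ n = 0 := by
  refine ⟨fun h => funext ?_, fun h => by simp [h]⟩
  exact Fintype.linearIndependent_iff.1
    ((dualLatticeBasis Γ).linearIndependent.restrict_scalars (R := ℤ)
      fun k l hkl => by simpa using hkl) n h

lemma prodChar_sum_dualLatticeBasis (n : Free.ChooseBasisIndex ℤ Γ → ℤ) :
    prodChar (∑ i, n i • dualLatticeBasis Γ i) = basisChar (latticeBasis Γ) n := by
  classical
  funext z
  have hcoord : ∀ i, dotForm m (dualLatticeBasis Γ i) z = (latticeBasis Γ).repr z i := fun i => by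
    rw [isSymm_dotForm.eq, ← LinearMap.BilinForm.dualBasis_repr_apply nondegenerate_dotForm,
      dualLatticeBasis, LinearMap.BilinForm.dualBasis_dualBasis _ isSymm_dotForm]
  simp only [prodChar, basisChar, map_sum, map_zsmul, LinearMap.sum_apply, LinearMap.smul_apply,
    hcoord, zsmul_eq_mul]

lemma average_conj_prodChar {η : Eucl m × ℝ} (hη : η ∈ dualLattice Γ) :
    ⨍ z in latticeDomain Γ, conj (prodChar η z) = if η = 0 then 1 else 0 := by
  obtain ⟨n, rfl⟩ := mem_dualLattice_iff.1 hη
  simp only [prodChar_sum_dualLatticeBasis, sum_dualLatticeBasis_eq_zero_iff]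
  exact average_conj_basisChar _ _ n

lemma ae_eq_const_of_dualLattice_fourier {F : Eucl m × ℝ → ℂ} {c : ℂ}
    (hF : MemLp F 2 (volume.restrict (latticeDomain Γ)))
    (hcoeff : ∀ η ∈ dualLattice Γ, ⨍ z in latticeDomain Γ, F z * conj (prodChar η z) =
      if η = 0 then c else 0) :
    ∀ᵐ z ∂volume.restrict (latticeDomain Γ), F z = c := by
  refine ae_eq_const_of_fourier _ volume hF fun n => ?_
  simp only [← prodChar_sum_dualLatticeBasis, ← sum_dualLatticeBasis_eq_zero_iff (Γ := Γ)]
  exact hcoeff _ (mem_dualLattice_iff.2 ⟨n, rfl⟩)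

end DualLattice

section Windowed

open ComplexConjugate

variable {m : ℕ} {Ω : Set ℝ}

/-- The function `(x, s) ↦ 1_Ω(s) K(x)`. -/
noncomputable def windowed {E : Type*} [Zero E] (Ω : Set ℝ) (K : Eucl m → E)
    (z : Eucl m × ℝ) : E :=
  Ω.indicator (fun _ => K z.1) z.2

lemma norm_windowed {E : Type*} [NormedAddCommGroup E] (Ω : Set ℝ) (K : Eucl m → E)
    (z : Eucl m × ℝ) : ‖windowed Ω K z‖ = windowed Ω (fun x => ‖K x‖) z :=
  norm_indicator_eq_indicator_norm _ _

lemma windowed_eq_mul (Ω : Set ℝ) (K : Eucl m → ℂ) (z : Eucl m × ℝ) :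
    windowed Ω K z = K z.1 * Ω.indicator 1 z.2 := by
  rw [windowed, ← Set.indicator_const_mul]
  simp only [Pi.one_apply, mul_one]

lemma norm_windowed_le_of_imp {C : Set ℝ} {K : Eucl m → ℂ} {z w : Eucl m × ℝ}
    (hfst : z.1 = w.1) (hsnd : z.2 ∈ Ω → w.2 ∈ C) : ‖windowed Ω K z‖ ≤ ‖windowed C K w‖ := by
  by_cases hz : z.2 ∈ Ω
  · rw [windowed, windowed, Set.indicator_of_mem hz, Set.indicator_of_mem (hsnd hz), hfst]
  · rw [windowed, Set.indicator_of_notMem hz, norm_zero]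
    exact norm_nonneg _

lemma integrable_windowed (hΩ : NullMeasurableSet Ω) (hbounded : Bornology.IsBounded Ω)
    {K : Eucl m → ℂ} (hK : Integrable K) : Integrable (windowed Ω K) := by
  have hindicator : Integrable (Ω.indicator (1 : ℝ → ℂ)) :=
    (integrableOn_const hbounded.measure_lt_top.ne).integrable_indicator₀ hΩ
  exact (hK.mul_prod hindicator).congr
    (Eventually.of_forall fun z => (windowed_eq_mul Ω K z).symm)

lemma integral_windowed_mul_conj_prodChar (hΩ : NullMeasurableSet Ω) (K : Eucl m → ℂ)
    (η : Eucl m × ℝ) :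
    ∫ z, windowed Ω K z * conj (prodChar η z) =
      (∫ s in Ω, Complex.exp (2 * Real.pi * Complex.I * ((-η.2 * s : ℝ) : ℂ))) *
        ∫ x, K x * conj (character η.1 x) := by
  have hfactor : ∀ z : Eucl m × ℝ, windowed Ω K z * conj (prodChar η z) =
      (K z.1 * conj (character η.1 z.1)) * Ω.indicator (fun s : ℝ =>
        Complex.exp (2 * Real.pi * Complex.I * ((-η.2 * s : ℝ) : ℂ))) z.2 := fun z => by
    rw [windowed_eq_mul, prodChar_eq_mul, map_mul]
    by_cases hz : z.2 ∈ Ω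
    · rw [Set.indicator_of_mem hz, Set.indicator_of_mem hz, ← Complex.exp_conj]
      simp [map_ofNat, mul_assoc]
    · rw [Set.indicator_of_notMem hz, Set.indicator_of_notMem hz, mul_zero, zero_mul, mul_zero]
  simp only [hfactor]
  rw [Measure.volume_eq_prod, integral_prod_mul (fun x => K x * conj (character η.1 x)),
    mul_comm, integral_indicator₀ hΩ]

end Windowed

section Periodized

open ComplexConjugate

variable {m : ℕ} {Γ : Submodule ℤ (Eucl m × ℝ)} {Ω : Set ℝ} {K : Eucl m → ℂ}

/-- The `Γ`-periodization of `windowed Ω K`. -/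
noncomputable def periodized (Γ : Submodule ℤ (Eucl m × ℝ)) (Ω : Set ℝ) (K : Eucl m → ℂ)
    (z : Eucl m × ℝ) : ℂ :=
  ∑' γ : Γ, windowed Ω K (γ + z)

/-- `K` is absolutely summable over the points of every translate of `Γ` lying over a given bounded
subset of `ℝ`, with a bound that does not depend on the translate. -/
def StripBounded (Γ : Submodule ℤ (Eucl m × ℝ)) (K : Eucl m → ℂ) : Prop :=
  ∀ C : Set ℝ, Bornology.IsBounded C →
    ∃ M, ∀ (z : Eucl m × ℝ) (S : Finset Γ), ∑ γ ∈ S, ‖windowed C K (γ + z)‖ ≤ M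

lemma periodized_vadd (γ : Γ) (z : Eucl m × ℝ) :
    periodized Γ Ω K (γ + z) = periodized Γ Ω K z := by
  rw [periodized, periodized, ← (Equiv.addRight γ).tsum_eq fun γ' : Γ => windowed Ω K (γ' + z)]
  simp only [Equiv.coe_addRight, Submodule.coe_add, add_assoc]

lemma exists_finset_lattice_translates (hdense : Dense (Prod.snd '' (Γ : Set (Eucl m × ℝ))))
    {U C : Set ℝ} (hU : IsOpen U) (hne : U.Nonempty) (hC : IsCompact C) :
    ∃ F : Finset Γ, ∀ t ∈ C, ∃ γ ∈ F, t + (γ : Eucl m × ℝ).2 ∈ U := by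
  have hcover : C ⊆ ⋃ γ : Γ, (· + (γ : Eucl m × ℝ).2) ⁻¹' U := fun t _ => by
    obtain ⟨_, hmem, γ, hγ, rfl⟩ := hdense.inter_open_nonempty ((t + ·) ⁻¹' U)
      (hU.preimage (continuous_const_add t)) (hne.preimage (add_left_surjective t))
    exact Set.mem_iUnion.2 ⟨⟨γ, hγ⟩, hmem⟩
  obtain ⟨F, hF⟩ := hC.elim_finite_subcover _
    (fun γ : Γ => hU.preimage (continuous_add_const (γ : Eucl m × ℝ).2)) hcover
  exact ⟨F, fun t ht => by simpa using hF ht⟩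

lemma stripBounded_of_sum_le (hdense : Dense (Prod.snd '' (Γ : Set (Eucl m × ℝ))))
    (hinterior : (interior Ω).Nonempty) {M : ℝ}
    (hM : ∀ (x : Eucl m) (S : Finset Γ), ∑ γ ∈ S, ‖windowed Ω K (γ + (x, (0 : ℝ)))‖ ≤ M) :
    StripBounded Γ K := by
  classical
  intro C hC
  obtain ⟨F, hF⟩ := exists_finset_lattice_translates hdense isOpen_interior hinterior
    (Metric.isCompact_of_isClosed_isBounded Metric.isClosed_cthickening (hC.cthickening (δ := 1)))
  refine ⟨F.card • M, fun z S => ?_⟩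
  obtain ⟨_, ⟨γ₀, hγ₀, rfl⟩, hdist⟩ := hdense.exists_dist_lt z.2 one_pos
  let shift (γ' : Γ) : Γ := ⟨γ₀, hγ₀⟩ + γ'
  let base (γ' : Γ) : Eucl m := z.1 - (shift γ' : Eucl m × ℝ).1
  have hpoint : ∀ γ : Γ, ‖windowed C K (γ + z)‖ ≤
      ∑ γ' ∈ F, ‖windowed Ω K ((γ + shift γ' : Γ) + (base γ', (0 : ℝ)))‖ := fun γ => by
    by_cases hγ : (γ : Eucl m × ℝ).2 + z.2 ∈ C
    · obtain ⟨γ', hγ', hmem⟩ := hF ((γ : Eucl m × ℝ).2 + γ₀.2)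
        (Metric.mem_cthickening_of_dist_le _ _ _ _ hγ (by simpa [dist_comm] using hdist.le))
      refine le_trans (norm_windowed_le_of_imp ?_ fun _ => ?_)
        (Finset.single_le_sum
          (f := fun γ' => ‖windowed Ω K ((γ + shift γ' : Γ) + (base γ', (0 : ℝ)))‖)
          (fun _ _ => norm_nonneg _) hγ')
      · simp [base]
      · simpa [shift, add_assoc] using interior_subset hmem
    · rw [windowed, Prod.snd_add, Set.indicator_of_notMem hγ, norm_zero]
      exact Finset.sum_nonneg fun _ _ => norm_nonneg _
  calc ∑ γ ∈ S, ‖windowed C K (γ + z)‖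
      ≤ ∑ γ ∈ S, ∑ γ' ∈ F, ‖windowed Ω K ((γ + shift γ' : Γ) + (base γ', (0 : ℝ)))‖ :=
        Finset.sum_le_sum fun γ _ => hpoint γ
    _ = ∑ γ' ∈ F, ∑ γ ∈ S.map (Equiv.addRight (shift γ')).toEmbedding,
          ‖windowed Ω K (γ + (base γ', (0 : ℝ)))‖ := by
        rw [Finset.sum_comm]
        simp only [Finset.sum_map, Equiv.coe_toEmbedding, Equiv.coe_addRight]
    _ ≤ F.card • M := Finset.sum_le_card_nsmul _ _ _ fun γ' _ => hM _ _

lemma StripBounded.summable (hK : StripBounded Γ K) (hΩ : Bornology.IsBounded Ω)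
    (z : Eucl m × ℝ) : Summable fun γ : Γ => ‖windowed Ω K (γ + z)‖ := by
  obtain ⟨M, hM⟩ := hK Ω hΩ
  exact summable_of_sum_le (fun _ => norm_nonneg _) (hM z)

lemma StripBounded.exists_norm_periodized_le (hK : StripBounded Γ K)
    (hΩ : Bornology.IsBounded Ω) : ∃ M, ∀ z, ‖periodized Γ Ω K z‖ ≤ M := by
  obtain ⟨M, hM⟩ := hK Ω hΩ
  exact ⟨M, fun z => (norm_tsum_le_tsum_norm (hK.summable hΩ z)).trans
    ((hK.summable hΩ z).tsum_le_of_sum_le (hM z))⟩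

lemma StripBounded.continuousAt_periodized (hK : StripBounded Γ K) (hΩ : Bornology.IsBounded Ω)
    (x : Eucl m) {s : ℝ} (hs : ∀ γ : Γ, (γ : Eucl m × ℝ).2 + s ∉ frontier Ω) :
    ContinuousAt (fun s => periodized Γ Ω K (x, s)) s := by
  refine tendsto_tsum_of_dominated_convergence (hK.summable (hΩ.cthickening (δ := 1)) (x, s))
    (fun γ => ?_) ?_
  · exact (continuousOn_const.continuousAt_indicator (hs γ)).comp
      (f := fun s' => (γ : Eucl m × ℝ).2 + s') (continuous_const_add _).continuousAt
  · filter_upwards [Metric.closedBall_mem_nhds s one_pos] with s' hs' γ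
    refine norm_windowed_le_of_imp rfl fun hmem =>
      Metric.mem_cthickening_of_dist_le _ _ _ _ hmem ?_
    simpa [dist_comm] using hs'

lemma StripBounded.slice_eq_of_ae_eq (hK : StripBounded Γ K) (hΩ : Bornology.IsBounded Ω)
    (hgen : IsGeneric Γ Ω) (hcont : Continuous fun x => periodized Γ Ω K (x, 0)) {c : ℂ}
    (hc : ∀ᵐ z, periodized Γ Ω K z = c) (x : Eucl m) : periodized Γ Ω K (x, 0) = c := by
  have hslice : (fun x => periodized Γ Ω K (x, 0)) =ᵐ[volume] fun _ => c := by
    filter_upwards [Measure.ae_ae_of_ae_prod hc] with x hx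
    have hmem := (hK.continuousAt_periodized hΩ x fun γ => by
      simpa using hgen γ γ.2).continuousWithinAt.mem_closure
        (Measure.dense_of_ae hx 0) (t := {c}) fun s hs => hs
    simpa using hmem
  exact congrFun ((hcont.ae_eq_iff_eq volume continuous_const).1 hslice) x

section Countable

variable [Countable Γ]

lemma ae_forall_add_notMem_frontier (hfrontier : volume (frontier Ω) = 0) :
    ∀ᵐ s : ℝ, ∀ γ : Γ, (γ : Eucl m × ℝ).2 + s ∉ frontier Ω :=
  ae_all_iff.2 fun γ =>
    (measurePreserving_add_left volume (γ : Eucl m × ℝ).2).quasiMeasurePreserving.ae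
      (measure_eq_zero_iff_ae_notMem.1 hfrontier)

lemma StripBounded.aestronglyMeasurable_periodized (hK : StripBounded Γ K)
    (hΩ : Bornology.IsBounded Ω) (hnull : NullMeasurableSet Ω) (hint : Integrable K) :
    AEStronglyMeasurable (periodized Γ Ω K) volume := by
  refine aestronglyMeasurable_of_tendsto_ae (u := (atTop : Filter (Finset Γ)))
    (f := fun S z => ∑ γ ∈ S, windowed Ω K (γ + z))
    (fun S => Finset.aestronglyMeasurable_fun_sum S fun γ _ => ?_)
    (Eventually.of_forall fun z => (hK.summable hΩ z).of_norm.hasSum)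
  exact (integrable_windowed hnull hΩ hint).1.comp_measurePreserving
    (measurePreserving_add_left volume (γ : Eucl m × ℝ))

lemma StripBounded.ae_eq_of_slice_eq (hK : StripBounded Γ K) (hΩ : Bornology.IsBounded Ω)
    (hdense : Dense (Prod.snd '' (Γ : Set (Eucl m × ℝ)))) (hfrontier : volume (frontier Ω) = 0)
    {c : ℂ} (hc : ∀ x, periodized Γ Ω K (x, 0) = c) : ∀ᵐ z, periodized Γ Ω K z = c := by
  have hlattice : ∀ x, Set.MapsTo (fun s => periodized Γ Ω K (x, s))
      (Prod.snd '' (Γ : Set (Eucl m × ℝ))) {c} := by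
    rintro x _ ⟨γ, hγ, rfl⟩
    have hshift := periodized_vadd (Ω := Ω) (K := K) ⟨γ, hγ⟩ (x - γ.1, 0)
    rw [hc, Prod.mk_add_mk] at hshift
    simpa using hshift
  filter_upwards [Measure.quasiMeasurePreserving_snd.ae
    (ae_forall_add_notMem_frontier (Γ := Γ) hfrontier)] with z hz
  have hmem := (hK.continuousAt_periodized hΩ z.1 hz).continuousWithinAt.mem_closure
    (hdense z.2) (hlattice z.1)
  simpa using hmem

end Countable

variable [DiscreteTopology Γ] [IsZLattice ℝ Γ]

lemma ae_periodized_eq_iff_restrict {c : ℂ} :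
    (∀ᵐ z, periodized Γ Ω K z = c) ↔
      ∀ᵐ z ∂volume.restrict (latticeDomain Γ), periodized Γ Ω K z = c := by
  refine ⟨ae_restrict_of_ae, fun hc => ?_⟩
  refine (isAddFundamentalDomain_latticeDomain Γ).measure_zero_of_invariant _ (fun γ => ?_) ?_
  · ext z
    rw [Set.mem_vadd_set_iff_neg_vadd_mem]
    change ¬ periodized Γ Ω K ((-γ : Γ) + z) = c ↔ ¬ periodized Γ Ω K z = c
    rw [periodized_vadd]
  · rwa [ae_iff, latticeDomain, Measure.restrict_apply₀' (ZSpan.fundamentalDomain_measurableSet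
      (latticeBasis Γ)).nullMeasurableSet] at hc

lemma average_periodized_mul_conj_prodChar (hΩ : Bornology.IsBounded Ω)
    (hnull : NullMeasurableSet Ω) (hint : Integrable K) {η : Eucl m × ℝ}
    (hη : η ∈ dualLattice Γ) :
    ⨍ z in latticeDomain Γ, periodized Γ Ω K z * conj (prodChar η z) =
      (ZLattice.covolume Γ : ℂ)⁻¹ *
        ((∫ s in Ω, Complex.exp (2 * Real.pi * Complex.I * ((-η.2 * s : ℝ) : ℂ))) *
          ∫ x, K x * conj (character η.1 x)) := by
  have hintegrable : Integrable fun z => windowed Ω K z * conj (prodChar η z) :=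
    (integrable_windowed hnull hΩ hint).mul_bdd (c := 1)
      (Complex.continuous_conj.comp (continuous_prodChar η)).aestronglyMeasurable
      (Eventually.of_forall fun z => by rw [RCLike.norm_conj, norm_prodChar])
  have hshift : ∀ (γ : Γ) (z : Eucl m × ℝ), windowed Ω K (γ +ᵥ z) * conj (prodChar η (γ +ᵥ z)) =
      windowed Ω K (γ + z) * conj (prodChar η z) := fun γ z => by
    rw [← prodChar_add_of_mem hη γ.2 z]
    rfl
  rw [← integral_windowed_mul_conj_prodChar hnull, integral_eq_setIntegral_tsum_vadd
    (isAddFundamentalDomain_latticeDomain Γ) hintegrable, setAverage_eq, volume_real_latticeDomain]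
  simp only [hshift, tsum_mul_right, periodized, Complex.real_smul, Complex.ofReal_inv]

theorem StripBounded.periodized_slice_eq_iff (hK : StripBounded Γ K)
    (hdense : Dense (Prod.snd '' (Γ : Set (Eucl m × ℝ)))) (hΩ : Bornology.IsBounded Ω)
    (hfrontier : volume (frontier Ω) = 0) (hgen : IsGeneric Γ Ω) (hint : Integrable K)
    (hcont : Continuous fun x => periodized Γ Ω K (x, 0)) (c : ℂ) :
    (∀ x, periodized Γ Ω K (x, 0) = c) ↔ ∀ η ∈ dualLattice Γ,
      (ZLattice.covolume Γ : ℂ)⁻¹ *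
        ((∫ s in Ω, Complex.exp (2 * Real.pi * Complex.I * ((-η.2 * s : ℝ) : ℂ))) *
          ∫ x, K x * conj (character η.1 x)) = if η = 0 then c else 0 := by
  have hnull := nullMeasurableSet_of_null_frontier hfrontier
  have : IsFiniteMeasure (volume.restrict (latticeDomain Γ)) :=
    isFiniteMeasure_restrict.2 (volume_latticeDomain_ne_top Γ)
  constructor
  · intro hc η hη
    rw [← average_periodized_mul_conj_prodChar hΩ hnull hint hη, average_congr
      ((ae_restrict_of_ae (hK.ae_eq_of_slice_eq hΩ hdense hfrontier hc)).mono fun z hz =>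
        congrArg (· * conj (prodChar η z)) hz), average, integral_const_mul]
    exact (congrArg (c * ·) (average_conj_prodChar hη)).trans (by simp)
  · intro hcoeff
    obtain ⟨M, hM⟩ := hK.exists_norm_periodized_le hΩ
    refine hK.slice_eq_of_ae_eq hΩ hgen hcont (ae_periodized_eq_iff_restrict.2 ?_)
    refine ae_eq_const_of_dualLattice_fourier (MemLp.of_bound
      (hK.aestronglyMeasurable_periodized hΩ hnull hint).restrict M (Eventually.of_forall hM))
      fun η hη => ?_
    rw [average_periodized_mul_conj_prodChar hΩ hnull hint hη, hcoeff η hη]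

end Periodized

section ModelSetSums

variable {m : ℕ} {Γ : Submodule ℤ (Eucl m × ℝ)} {Ω : Set ℝ}

/-- The lattice points over the window correspond to the points of the model set. -/
noncomputable def stripEquiv (hinj : Set.InjOn Prod.fst (Γ : Set (Eucl m × ℝ))) (Ω : Set ℝ) :
    {γ : Γ | (γ : Eucl m × ℝ).2 ∈ Ω} ≃ modelSet Γ Ω :=
  Equiv.ofBijective (fun γ => ⟨(γ.1 : Eucl m × ℝ).1, γ.1, γ.1.2, γ.2, rfl⟩)
    ⟨fun γ γ' h => Subtype.ext (Subtype.ext (hinj γ.1.2 γ'.1.2 (congrArg Subtype.val h))),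
      fun ⟨_, γ, hγ, hmem, hfst⟩ => ⟨⟨⟨γ, hγ⟩, hmem⟩, Subtype.ext hfst⟩⟩

lemma hasSum_windowed_iff {E : Type*} [AddCommMonoid E] [TopologicalSpace E]
    (hinj : Set.InjOn Prod.fst (Γ : Set (Eucl m × ℝ))) {K : Eucl m → E} {x : Eucl m} {s : E} :
    HasSum (fun γ : Γ => windowed Ω K (γ + (x, (0 : ℝ)))) s ↔
      HasSum (fun y : modelSet Γ Ω => K ((y : Eucl m) + x)) s := by
  have hindicator : (fun γ : Γ => windowed Ω K (γ + (x, (0 : ℝ)))) =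
      {γ : Γ | (γ : Eucl m × ℝ).2 ∈ Ω}.indicator fun γ => K ((γ : Eucl m × ℝ).1 + x) := by
    funext γ
    rw [windowed, Prod.snd_add, add_zero]
    rfl
  rw [hindicator, ← hasSum_subtype_iff_indicator, ← (stripEquiv hinj Ω).hasSum_iff]
  rfl

lemma stripBounded_of_hasSum_le (hinj : Set.InjOn Prod.fst (Γ : Set (Eucl m × ℝ)))
    (hdense : Dense (Prod.snd '' (Γ : Set (Eucl m × ℝ)))) (hinterior : (interior Ω).Nonempty)
    {K : Eucl m → ℂ} {M : ℝ} (hM : ∀ x, ∃ s ≤ M,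
      HasSum (fun y : modelSet Γ Ω => ‖K ((y : Eucl m) + x)‖) s) : StripBounded Γ K := by
  refine stripBounded_of_sum_le hdense hinterior (M := M) fun x S => ?_
  obtain ⟨s, hs, hsum⟩ := hM x
  have hstrip := (hasSum_windowed_iff hinj (K := fun x => ‖K x‖)).2 hsum
  simp only [← norm_windowed] at hstrip
  exact (sum_le_hasSum S (fun _ _ => norm_nonneg _) hstrip).trans hs

end ModelSetSums

section TimeFrequency

open ComplexConjugate

variable {m : ℕ}

lemma coeFn_translation (x : Eucl m) (f : L2 m) :
    translation x f =ᵐ[volume] fun t => f (t - x) :=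
  Lp.coeFn_compMeasurePreserving f (measurePreserving_sub_right volume x)

lemma coeFn_modulation (ω : Eucl m) (f : L2 m) :
    modulation ω f =ᵐ[volume] fun t => character ω t * f t :=
  (memLp_character_mul ω f).coeFn_toLp

lemma norm_translation (x : Eucl m) (f : L2 m) : ‖translation x f‖ = ‖f‖ :=
  Lp.norm_compMeasurePreserving f _

lemma inner_translation_translation (x : Eucl m) (f g : L2 m) :
    inner ℂ (translation x f) (translation x g) = inner ℂ f g :=
  (Lp.compMeasurePreservingₗᵢ ℂ (fun t : Eucl m => t - x)
    (measurePreserving_sub_right volume x)).inner_map_map f g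

lemma ae_comp_sub {p : Eucl m → Prop} (hp : ∀ᵐ t, p t) (x : Eucl m) : ∀ᵐ t, p (t - x) :=
  (measurePreserving_sub_right volume x).quasiMeasurePreserving.ae hp

lemma coeFn_translation_modulation (x ω : Eucl m) (f : L2 m) :
    translation x (modulation ω f) =ᵐ[volume] fun t => character ω (t - x) * f (t - x) :=
  (coeFn_translation x _).trans (ae_comp_sub (coeFn_modulation ω f) x)

lemma translation_translation (x y : Eucl m) (f : L2 m) :
    translation x (translation y f) = translation (x + y) f := by
  refine Lp.ext ?_
  filter_upwards [coeFn_translation x (translation y f), ae_comp_sub (coeFn_translation y f) x,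
    coeFn_translation (x + y) f] with t hx hy hxy
  rw [hx, hy, hxy, sub_sub]

lemma translation_zero (f : L2 m) : translation (0 : Eucl m) f = f := by
  refine Lp.ext ?_
  filter_upwards [coeFn_translation 0 f] with t ht
  rw [ht, sub_zero]

lemma modulation_zero (f : L2 m) : modulation (0 : Eucl m) f = f := by
  refine Lp.ext ?_
  filter_upwards [coeFn_modulation 0 f] with t ht
  rw [ht, character, inner_zero_left, Complex.ofReal_zero, mul_zero, Complex.exp_zero, one_mul]

lemma continuous_translation (f : L2 m) : Continuous fun x : Eucl m => translation x f := by
  let shift : Eucl m → C(Eucl m, Eucl m) := fun x => ⟨fun t => t - x, by fun_prop⟩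
  have hshift : Continuous shift :=
    ContinuousMap.continuous_of_continuous_uncurry _ (continuous_snd.sub continuous_fst)
  exact (continuous_const (y := f)).compMeasurePreservingLp hshift
    (fun x => measurePreserving_sub_right volume x) ENNReal.ofNat_ne_top

lemma inner_translation_left (x : Eucl m) (f g : L2 m) :
    inner ℂ (translation x f) g = inner ℂ f (translation (-x) g) := by
  rw [← inner_translation_translation (-x), translation_translation, neg_add_cancel,
    translation_zero]

lemma character_add (ω s t : Eucl m) :
    character ω (s + t) = character ω s * character ω t := by
  simp only [character, inner_add_right, Complex.ofReal_add, mul_add, Complex.exp_add]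

lemma conj_character_mul_self (ω t : Eucl m) : conj (character ω t) * character ω t = 1 := by
  rw [Complex.conj_mul', norm_character, Complex.ofReal_one, one_pow]

lemma integrable_mul_conj_character {F : Eucl m → ℂ} (hF : Integrable F) (ω : Eucl m) :
    Integrable fun t => F t * conj (character ω t) :=
  hF.mul_bdd (c := 1) (Complex.continuous_conj.comp (continuous_character ω)).aestronglyMeasurable
    (Eventually.of_forall fun t => by rw [RCLike.norm_conj, norm_character])

lemma inner_translation_modulation (f g : L2 m) (y ω : Eucl m) :
    inner ℂ (translation y (modulation ω g)) f
      = ∫ t, f (t + y) * conj (g t) * conj (character ω t) := by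
  rw [inner_translation_left, L2.inner_def]
  refine integral_congr_ae ?_
  filter_upwards [coeFn_modulation ω g, coeFn_translation (-y) f] with t hg hf
  rw [hg, hf, RCLike.inner_apply, map_mul, sub_neg_eq_add]
  ring

lemma norm_modulation (ω : Eucl m) (f : L2 m) : ‖modulation ω f‖ = ‖f‖ := by
  rw [Lp.norm_def, Lp.norm_def]
  congr 1
  refine eLpNorm_congr_norm_ae ?_
  filter_upwards [coeFn_modulation ω f] with t ht
  rw [ht, norm_mul, norm_character, one_mul]

end TimeFrequency

section Correlation

open ComplexConjugate

variable {m : ℕ}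

/-- The cross-correlation `y ↦ ∫ p(t + y) conj(q(t)) dt`. -/
noncomputable def correlation (p q : Eucl m → ℂ) (y : Eucl m) : ℂ :=
  ∫ t, p (t + y) * conj (q t)

lemma correlation_eq_convolution (p q : Eucl m → ℂ) :
    correlation p q =
      convolution (fun t => conj (q (-t))) p (ContinuousLinearMap.mul ℂ ℂ) volume := by
  funext y
  rw [correlation, convolution, ← integral_neg_eq_self]
  refine integral_congr_ae (Eventually.of_forall fun t => ?_)
  simp only [ContinuousLinearMap.mul_apply']
  rw [mul_comm, neg_add_eq_sub]

lemma integrable_correlation {p q : Eucl m → ℂ} (hp : Integrable p) (hq : Integrable q) :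
    Integrable (correlation p q) := by
  rw [correlation_eq_convolution]
  exact (Complex.conjCLE.integrable_comp_iff.2 hq.comp_neg).integrable_convolution _ hp

lemma correlation_mul_conj_character (p q : Eucl m → ℂ) (ω y : Eucl m) :
    correlation p q y * conj (character ω y) =
      correlation (fun t => p t * conj (character ω t))
        (fun t => q t * conj (character ω t)) y := by
  rw [correlation, correlation, ← integral_mul_const]
  refine integral_congr_ae (Eventually.of_forall fun t => ?_)
  simp only [character_add, map_mul, Complex.conj_conj]
  linear_combination
    (-(p (t + y) * conj (q t) * conj (character ω y))) * conj_character_mul_self ω t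

lemma integral_correlation {p q : Eucl m → ℂ} (hp : Integrable p) (hq : Integrable q) :
    ∫ y, correlation p q y = (∫ t, p t) * conj (∫ t, q t) := by
  have hq' : Integrable fun t => conj (q (-t)) :=
    Complex.conjCLE.integrable_comp_iff.2 hq.comp_neg
  rw [correlation_eq_convolution, integral_convolution _ hq' hp, ContinuousLinearMap.mul_apply',
    mul_comm, integral_neg_eq_self fun t => conj (q t), integral_conj]

theorem integral_correlation_mul_conj_character {p q : Eucl m → ℂ} (hp : Integrable p)
    (hq : Integrable q) (ω : Eucl m) :
    ∫ y, correlation p q y * conj (character ω y) =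
      (∫ t, p t * conj (character ω t)) * conj (∫ t, q t * conj (character ω t)) := by
  simp only [correlation_mul_conj_character]
  exact integral_correlation (integrable_mul_conj_character hp ω)
    (integrable_mul_conj_character hq ω)

/-- The product `f · conj(T_x f')`, whose Fourier transform is, up to a phase, the short-time
Fourier transform of `f` with window `f'`. -/
noncomputable def translateProduct (x : Eucl m) (f f' : L2 m) (t : Eucl m) : ℂ :=
  f t * conj (f' (t - x))

lemma integrable_translateProduct (x : Eucl m) (f f' : L2 m) :
    Integrable (translateProduct x f f') :=
  (Lp.memLp f).integrable_mul
    ((Lp.memLp f').comp_measurePreserving (measurePreserving_sub_right volume x)).star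

lemma integral_translateProduct_mul_conj_character (x ω : Eucl m) (f f' : L2 m) :
    ∫ t, translateProduct x f f' t * conj (character ω t) =
      conj (character ω x) * inner ℂ (translation x (modulation ω f')) f := by
  rw [L2.inner_def, ← integral_const_mul]
  refine integral_congr_ae ?_
  filter_upwards [coeFn_translation_modulation x ω f'] with t ht
  have hphase : character ω t = character ω x * character ω (t - x) := by
    rw [← character_add, add_sub_cancel]
  rw [ht, RCLike.inner_apply, translateProduct, hphase, map_mul, map_mul]
  ring

/-- The phases of the two short-time Fourier transforms cancel. -/
theorem integral_correlation_translateProduct (x ω : Eucl m) (f f' g h : L2 m) :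
    ∫ y, correlation (translateProduct x f f') (translateProduct x g h) y *
        conj (character ω y) =
      inner ℂ (translation x (modulation ω f')) f *
        inner ℂ g (translation x (modulation ω h)) := by
  rw [integral_correlation_mul_conj_character (integrable_translateProduct x f f')
    (integrable_translateProduct x g h), integral_translateProduct_mul_conj_character,
    integral_translateProduct_mul_conj_character, map_mul, Complex.conj_conj, inner_conj_symm]
  linear_combination (inner ℂ (translation x (modulation ω f')) f *
    inner ℂ g (translation x (modulation ω h))) * conj_character_mul_self ω x

end Correlation

section TranslatedSupport

variable {E : Type*} [AddGroup E] [MeasurableSpace E] [MeasurableAdd E] {μ : Measure E}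
  [μ.IsAddRightInvariant]

lemma integral_eq_setIntegral_comp_add {D : Set E} {F : E → ℂ} {z : E}
    (hF : ∀ᵐ t ∂μ, t - z ∉ D → F t = 0) : ∫ t, F t ∂μ = ∫ u in D, F (u + z) ∂μ := by
  rw [← integral_add_right_eq_self _ z, setIntegral_eq_integral_of_ae_compl_eq_zero]
  filter_upwards [(measurePreserving_add_right μ z).quasiMeasurePreserving.ae hF] with u hu
  rwa [add_sub_cancel_right] at hu

end TranslatedSupport

section Cells

open Module ComplexConjugate

variable {ι E : Type*} [Fintype ι] [NormedAddCommGroup E] [NormedSpace ℝ E] (b : Basis ι ℝ E)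

/-- The point with integer coordinates `w` in the basis `b`. -/
noncomputable def basisPoint (w : ι → ℤ) : E :=
  b.equivFun.symm fun i => w i

lemma repr_basisPoint (w : ι → ℤ) (i : ι) : b.repr (basisPoint b w) i = w i := by
  rw [basisPoint, ← b.equivFun_apply, LinearEquiv.apply_symm_apply]

lemma basisPoint_zero : basisPoint b 0 = 0 := by
  simp only [basisPoint, Pi.zero_apply, Int.cast_zero, ← Pi.zero_def, map_zero]

lemma basisPoint_add (v w : ι → ℤ) : basisPoint b (v + w) = basisPoint b v + basisPoint b w := by
  simp only [basisPoint, Pi.add_apply, Int.cast_add, ← Pi.add_def, map_add]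

lemma basisChar_basisPoint (n v : ι → ℤ) : basisChar b n (basisPoint b v) = 1 := by
  simp only [basisChar, repr_basisPoint]
  rw [Complex.exp_eq_one_iff]
  refine ⟨∑ i, n i * v i, ?_⟩
  push_cast
  ring

/-- The translate of the fundamental domain of `b` by the point with coordinates `w`. -/
def cell (w : ι → ℤ) : Set E :=
  {t | t - basisPoint b w ∈ ZSpan.fundamentalDomain b}

variable {b}

lemma mem_cell_iff {w : ι → ℤ} {t : E} : t ∈ cell b w ↔ ∀ i, ⌊b.repr t i⌋ = w i := by
  simp only [cell, Set.mem_ofPred_eq, ZSpan.mem_fundamentalDomain, map_sub, Finsupp.sub_apply,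
    repr_basisPoint, Int.floor_eq_iff, Set.mem_Ico]
  exact forall_congr' fun i => and_congr sub_nonneg (sub_lt_iff_lt_add' (b := (w i : ℝ)))

lemma sub_basisPoint_mem_cell {v w : ι → ℤ} {t : E} :
    t - basisPoint b v ∈ cell b w ↔ t ∈ cell b (w + v) := by
  rw [cell, cell, Set.mem_ofPred_eq, Set.mem_ofPred_eq, basisPoint_add, sub_sub, add_comm]

lemma eq_of_mem_cell {v w : ι → ℤ} {t : E} (hv : t ∈ cell b v) (hw : t ∈ cell b w) : v = w :=
  funext fun i => (mem_cell_iff.1 hv i).symm.trans (mem_cell_iff.1 hw i)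

lemma iUnion_cell : ⋃ w, cell b w = Set.univ :=
  Set.eq_univ_of_forall fun _ => Set.mem_iUnion.2 ⟨_, mem_cell_iff.2 fun _ => rfl⟩

variable [MeasurableSpace E] [BorelSpace E]

lemma measurableSet_cell (w : ι → ℤ) : MeasurableSet (cell b w) :=
  (ZSpan.fundamentalDomain_measurableSet b).preimage (measurable_id.sub_const _)

variable {μ : Measure E} [μ.IsAddHaarMeasure]

lemma measure_cell (w : ι → ℤ) : μ (cell b w) = μ (ZSpan.fundamentalDomain b) :=
  (measurePreserving_sub_right μ (basisPoint b w)).measure_preimage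
    (ZSpan.fundamentalDomain_measurableSet b).nullMeasurableSet

lemma measure_cell_ne_top (w : ι → ℤ) : μ (cell b w) ≠ ∞ := by
  rw [measure_cell]
  exact measure_fundamentalDomain_ne_top b μ

lemma integral_mul_conj_basisChar {F : E → ℂ} {z : E}
    (hF : ∀ᵐ t ∂μ, t - z ∉ ZSpan.fundamentalDomain b → F t = 0) (n : ι → ℤ) :
    ∫ t, F t * conj (basisChar b n t) ∂μ = μ.real (ZSpan.fundamentalDomain b) *
      (conj (basisChar b n z) *
        ⨍ u in ZSpan.fundamentalDomain b, F (u + z) * conj (basisChar b n u) ∂μ) := by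
  have hvol : (μ.real (ZSpan.fundamentalDomain b) : ℂ) ≠ 0 :=
    Complex.ofReal_ne_zero.2 (measureReal_fundamentalDomain_pos b μ).ne'
  rw [integral_eq_setIntegral_comp_add (z := z)
    (hF.mono fun t ht hmem => by rw [ht hmem, zero_mul]), setAverage_eq, Complex.real_smul,
    Complex.ofReal_inv, mul_left_comm, mul_inv_cancel_left₀ hvol, ← integral_const_mul]
  simp only [basisChar_add, map_mul]
  refine integral_congr_ae (Eventually.of_forall fun u => ?_)
  ring

/-- Parseval's identity for two functions living on different cells of the lattice: the
characters do not see the lattice vector `z - z'` between the cells. -/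
theorem hasSum_fourier_of_support {F H : E → ℂ} {z z' : E} {v : ι → ℤ}
    (hz : z - z' = basisPoint b v) (hF2 : MemLp F 2 μ) (hH2 : MemLp H 2 μ)
    (hF : ∀ᵐ t ∂μ, t - z ∉ ZSpan.fundamentalDomain b → F t = 0)
    (hH : ∀ᵐ t ∂μ, t - z' ∉ ZSpan.fundamentalDomain b → H t = 0) :
    HasSum (fun n : ι → ℤ => (∫ t, F t * conj (basisChar b n t) ∂μ) *
        conj (∫ t, H t * conj (basisChar b n t) ∂μ))
      (μ.real (ZSpan.fundamentalDomain b) * ∫ t, F t * conj (H (t - basisPoint b v)) ∂μ) := by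
  set V : ℂ := (μ.real (ZSpan.fundamentalDomain b) : ℂ) with hV
  have hvol : V ≠ 0 := Complex.ofReal_ne_zero.2 (measureReal_fundamentalDomain_pos b μ).ne'
  have hparseval := (hasSum_fourier_fundamentalDomain b μ (F := fun u => F (u + z))
    (H := fun u => H (u + z'))
    ((hF2.comp_measurePreserving (measurePreserving_add_right μ z)).restrict _)
    ((hH2.comp_measurePreserving (measurePreserving_add_right μ z')).restrict _)).mul_left (V * V)
  have hshift : ∀ u, u + z - basisPoint b v = u + z' := fun u => by rw [← hz]; abel
  have hvalue : V * ∫ t, F t * conj (H (t - basisPoint b v)) ∂μ = V * V *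
      ⨍ u in ZSpan.fundamentalDomain b, F (u + z) * conj (H (u + z')) ∂μ := by
    rw [integral_eq_setIntegral_comp_add (z := z)
      (hF.mono fun t ht hmem => by rw [ht hmem, zero_mul]), setAverage_eq, Complex.real_smul,
      Complex.ofReal_inv, ← hV, mul_assoc, mul_inv_cancel_left₀ hvol]
    simp only [hshift]
  have hchar : ∀ n, basisChar b n z = basisChar b n z' := fun n => by
    rw [← sub_add_cancel z z', hz, basisChar_add, basisChar_basisPoint, one_mul]
  have hphase : ∀ n, conj (basisChar b n z') * basisChar b n z' = 1 := fun n => by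
    rw [Complex.conj_mul', norm_basisChar, Complex.ofReal_one, one_pow]
  rw [hvalue]
  refine hparseval.congr_fun fun n => ?_
  rw [integral_mul_conj_basisChar hF, integral_mul_conj_basisChar hH, hchar]
  simp only [map_mul, Complex.conj_conj, Complex.conj_ofReal]
  linear_combination (V * V *
    (⨍ u in ZSpan.fundamentalDomain b, F (u + z) * conj (basisChar b n u) ∂μ) *
    conj (⨍ u in ZSpan.fundamentalDomain b, H (u + z') * conj (basisChar b n u) ∂μ)) * hphase n

end Cells

section CellFunctions

open Module ComplexConjugate

variable {m : ℕ} {b : Basis (Fin m) ℝ (Eucl m)} {v w w' : Fin m → ℤ} {f f' : L2 m}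

/-- `f` is essentially bounded and vanishes almost everywhere outside the cell of `w`. -/
structure IsCellFunction (b : Basis (Fin m) ℝ (Eucl m)) (w : Fin m → ℤ) (f : L2 m) : Prop where
  memLp_top : MemLp f ∞ volume
  ae_eq_zero : ∀ᵐ t, t ∉ cell b w → f t = 0

lemma IsCellFunction.translation_modulation (hf : IsCellFunction b w f) (v : Fin m → ℤ)
    (ω : Eucl m) : IsCellFunction b (w + v) (translation (basisPoint b v) (modulation ω f)) where
  memLp_top := by
    refine (hf.memLp_top.comp_measurePreserving
      (measurePreserving_sub_right volume (basisPoint b v))).of_le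
      (Lp.aestronglyMeasurable _) ?_
    filter_upwards [coeFn_translation_modulation (basisPoint b v) ω f] with t ht
    rw [ht, norm_mul, norm_character, one_mul, Function.comp_apply]
  ae_eq_zero := by
    filter_upwards [coeFn_translation_modulation (basisPoint b v) ω f,
      ae_comp_sub hf.ae_eq_zero (basisPoint b v)] with t ht hzero hmem
    rw [ht, hzero (mt sub_basisPoint_mem_cell.1 hmem), mul_zero]

lemma isCellFunction_indicatorConstLp {s : Set (Eucl m)} (hs : MeasurableSet s)
    (hfinite : volume s ≠ ∞) (hsub : s ⊆ cell b w) :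
    IsCellFunction b w (indicatorConstLp 2 hs hfinite 1) where
  memLp_top := (memLp_indicator_const ∞ hs (1 : ℂ) (Or.inr hfinite)).ae_eq
    indicatorConstLp_coeFn.symm
  ae_eq_zero := by
    filter_upwards [indicatorConstLp_coeFn_notMem (p := 2) (hs := hs) (hμs := hfinite)
      (c := (1 : ℂ))] with t ht hmem
    exact ht fun h => hmem (hsub h)

lemma eq_zero_of_inner_cellFunction_eq_zero (b : Basis (Fin m) ℝ (Eucl m)) (f : L2 m)
    (hf : ∀ g ∈ {g | ∃ w, IsCellFunction b w g}, inner ℂ g f = 0) : f = 0 := by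
  have hcell : ∀ w, ∀ᵐ t ∂volume.restrict (cell b w), f t = 0 := fun w => by
    have : IsFiniteMeasure (volume.restrict (cell b w)) :=
      isFiniteMeasure_restrict.2 (measure_cell_ne_top w)
    have hint := ((Lp.memLp f).restrict (cell b w)).integrable one_le_two
    refine hint.ae_eq_zero_of_forall_setIntegral_eq_zero fun s hs _ => ?_
    have hmeas := hs.inter (measurableSet_cell (b := b) w)
    have hfinite := ne_top_of_le_ne_top (measure_cell_ne_top (μ := volume) w)
      (measure_mono (Set.inter_subset_right (s := s) (t := cell b w)))
    rw [Measure.restrict_restrict hs, ← L2.inner_indicatorConstLp_one hmeas hfinite]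
    exact hf _ ⟨w, isCellFunction_indicatorConstLp hmeas hfinite Set.inter_subset_right⟩
  have hall := (ae_restrict_iUnion_iff _ _).2 hcell
  rw [iUnion_cell, Measure.restrict_univ] at hall
  exact (Lp.eq_zero_iff_ae_eq_zero).2 hall

lemma inner_eq_zero_of_cell_ne (hf : IsCellFunction b w f) (hf' : IsCellFunction b w' f')
    (hw : w ≠ w') : inner ℂ f' f = 0 := by
  rw [L2.inner_def]
  refine integral_eq_zero_of_ae ?_
  filter_upwards [hf.ae_eq_zero, hf'.ae_eq_zero] with t ht ht'
  by_cases hmem : t ∈ cell b w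
  · rw [ht' fun hmem' => hw (eq_of_mem_cell hmem hmem'), inner_zero_left, Pi.zero_apply]
  · rw [ht hmem, inner_zero_right, Pi.zero_apply]

lemma exists_isCellFunction_ne_zero (b : Basis (Fin m) ℝ (Eucl m)) (w : Fin m → ℤ) :
    ∃ f : L2 m, IsCellFunction b w f ∧ f ≠ 0 := by
  refine ⟨_, isCellFunction_indicatorConstLp (measurableSet_cell w) (measure_cell_ne_top w)
    subset_rfl, fun hzero => ?_⟩
  have hnorm := congrArg norm hzero
  rw [norm_indicatorConstLp two_ne_zero ENNReal.ofNat_ne_top, norm_one, one_mul, norm_zero,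
    measureReal_def, measure_cell] at hnorm
  exact (Real.rpow_pos_of_pos (measureReal_fundamentalDomain_pos b volume) _).ne' hnorm

end CellFunctions

section FrequencyLattice

open Module Matrix

variable {m : ℕ} (A : Matrix.GeneralLinearGroup (Fin m) ℝ)

lemma isUnit_det_transpose : IsUnit (A.1.transpose).det := by
  rw [Matrix.det_transpose]
  exact (Matrix.isUnit_iff_isUnit_det _).1 A.isUnit

/-- The columns of `A⁻ᵀ`, a basis of the lattice dual to `Aℤ^m`. -/
noncomputable def dualBasisOf : Basis (Fin m) ℝ (Eucl m) :=
  Basis.ofEquivFun ((WithLp.linearEquiv 2 ℝ (Fin m → ℝ)).trans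
    (Matrix.toLin'OfInv (Matrix.nonsing_inv_mul _ (isUnit_det_transpose A))
      (Matrix.mul_nonsing_inv _ (isUnit_det_transpose A))))

lemma repr_dualBasisOf (t : Eucl m) (i : Fin m) :
    (dualBasisOf A).repr t i = (A.1.transpose *ᵥ t.ofLp) i := by
  rw [dualBasisOf, Basis.ofEquivFun_repr_apply, LinearEquiv.trans_apply,
    Matrix.toLin'OfInv_apply, Matrix.toLin'_apply]
  rfl

lemma basisPoint_dualBasisOf (v : Fin m → ℤ) :
    basisPoint (dualBasisOf A) v = latticePoint (A.1.transpose)⁻¹ v := by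
  apply (dualBasisOf A).repr.injective
  ext i
  rw [repr_basisPoint, repr_dualBasisOf, latticePoint, Matrix.mulVec_mulVec,
    Matrix.mul_nonsing_inv _ (isUnit_det_transpose A), Matrix.one_mulVec]

lemma character_latticePoint (n : Fin m → ℤ) (t : Eucl m) :
    character (latticePoint A.1 n) t = basisChar (dualBasisOf A) n t := by
  have hinner : inner ℝ (latticePoint A.1 n) t = ∑ i, n i * (dualBasisOf A).repr t i := by
    rw [EuclideanSpace.inner_eq_star_dotProduct, star_trivial, latticePoint, dotProduct_comm,
      ← Matrix.vecMul_transpose, ← Matrix.dotProduct_mulVec, dotProduct]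
    simp only [repr_dualBasisOf]
  rw [character, basisChar, hinner]

lemma volume_real_fundamentalDomain_dualBasisOf :
    volume.real (ZSpan.fundamentalDomain (dualBasisOf A)) = |A.1.det|⁻¹ := by
  let e := EuclideanSpace.basisFun (Fin m) ℝ
  have hunit : volume.real (ZSpan.fundamentalDomain e.toBasis) = 1 := by
    rw [measureReal_congr (ZSpan.fundamentalDomain_ae_parallelepiped e.toBasis volume),
      e.coe_toBasis, measureReal_def, e.volume_parallelepiped, ENNReal.toReal_one]
  have hmatrix : (dualBasisOf A).toMatrix e.toBasis = A.1.transpose := by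
    ext i j
    rw [Basis.toMatrix_apply, repr_dualBasisOf, e.coe_toBasis, EuclideanSpace.basisFun_apply,
      PiLp.ofLp_single, Matrix.mulVec_single_one, Matrix.col_apply]
  have hdet : e.toBasis.det (dualBasisOf A) * A.1.det = 1 := by
    rw [← Matrix.det_transpose A.1, ← hmatrix, Basis.det_apply, ← Matrix.det_mul,
      Basis.toMatrix_mul_toMatrix_flip, Matrix.det_one]
  rw [ZSpan.measureReal_fundamentalDomain (dualBasisOf A) volume e.toBasis, hunit, mul_one,
    eq_inv_of_mul_eq_one_left hdet, abs_inv]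

end FrequencyLattice

section AbsoluteSums

variable {α β E : Type*} [NormedAddCommGroup E]

lemma exists_hasSum_norm_le_of_prod [CompleteSpace E] {κ : α × β → E} {k : α → E} {s : ℝ}
    (hs : HasSum (fun p => ‖κ p‖) s) (hk : ∀ a, HasSum (fun b => κ (a, b)) (k a)) :
    ∃ s' ≤ s, HasSum (fun a => ‖k a‖) s' := by
  have hfiber : ∀ a, ‖k a‖ ≤ ∑' b, ‖κ (a, b)‖ := fun a =>
    (hk a).tsum_eq ▸ norm_tsum_le_tsum_norm (hs.summable.prod_factor a)
  have hsummable : Summable fun a => ‖k a‖ :=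
    hs.summable.prod.of_nonneg_of_le (fun _ => norm_nonneg _) hfiber
  refine ⟨_, ?_, hsummable.hasSum⟩
  rw [← hs.tsum_eq, hs.summable.tsum_prod]
  exact hsummable.tsum_le_tsum hfiber hs.summable.prod

lemma IsBessel.exists_hasSum_norm_le {m : ℕ} {ι : Type*} {e d : ι → L2 m} (he : IsBessel e)
    (hd : IsBessel d) : ∃ C, ∀ f f' : L2 m, ∃ s ≤ C * (‖f‖ ^ 2 + ‖f'‖ ^ 2),
      HasSum (fun i => ‖inner ℂ (e i) f * inner ℂ f' (d i)‖) s := by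
  obtain ⟨B, hB, he⟩ := he
  obtain ⟨B', hB', hd⟩ := hd
  refine ⟨B + B', fun f f' => ?_⟩
  obtain ⟨hesum, hele⟩ := he f
  obtain ⟨hdsum, hdle⟩ := hd f'
  have hterm : ∀ i, ‖inner ℂ (e i) f * inner ℂ f' (d i)‖ ≤
      ‖inner ℂ (e i) f‖ ^ 2 + ‖inner ℂ (d i) f'‖ ^ 2 := fun i => by
    rw [norm_mul, norm_inner_symm f']
    nlinarith [two_mul_le_add_sq ‖inner ℂ (e i) f‖ ‖inner ℂ (d i) f'‖,
      norm_nonneg (inner ℂ (e i) f), norm_nonneg (inner ℂ (d i) f')]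
  have hsummable := (hesum.add hdsum).of_nonneg_of_le (fun _ => norm_nonneg _) hterm
  refine ⟨_, ?_, hsummable.hasSum⟩
  have htsum := hsummable.tsum_le_tsum hterm (hesum.add hdsum)
  rw [hesum.tsum_add hdsum] at htsum
  nlinarith [mul_nonneg hB.le (sq_nonneg ‖f'‖), mul_nonneg hB'.le (sq_nonneg ‖f‖)]

end AbsoluteSums

section GaborKernel

open Module ComplexConjugate

variable {m L : ℕ} {A : Matrix.GeneralLinearGroup (Fin m) ℝ} {w w' : Fin m → ℤ} {f f' : L2 m}

lemma IsCellFunction.memLp_mul_conj {b : Basis (Fin m) ℝ (Eucl m)} (hf : IsCellFunction b w f)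
    (g : L2 m) (y : Eucl m) : MemLp (fun t => f (t + y) * conj (g t)) 2 volume :=
  (Lp.memLp g).star.mul
    (hf.memLp_top.comp_measurePreserving (measurePreserving_add_right volume y))

lemma IsCellFunction.ae_mul_conj_eq_zero {b : Basis (Fin m) ℝ (Eucl m)}
    (hf : IsCellFunction b w f) (g : L2 m) (y : Eucl m) :
    ∀ᵐ t, t - (basisPoint b w - y) ∉ ZSpan.fundamentalDomain b → f (t + y) * conj (g t) = 0 := by
  filter_upwards [(measurePreserving_add_right volume y).quasiMeasurePreserving.ae
    hf.ae_eq_zero] with t ht hmem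
  rw [ht fun h => hmem (by rwa [sub_sub_eq_add_sub]), zero_mul]

/-- Parseval's identity removes the sum over the frequencies `Aℤ^m`. -/
theorem hasSum_frequencies (hf : IsCellFunction (dualBasisOf A) w f)
    (hf' : IsCellFunction (dualBasisOf A) w' f') (g h : L2 m) (y : Eucl m) :
    HasSum (fun n => inner ℂ (translation y (modulation (latticePoint A.1 n) g)) f *
        inner ℂ f' (translation y (modulation (latticePoint A.1 n) h)))
      (((|A.1.det|⁻¹ : ℝ) : ℂ) *
        correlation (translateProduct (basisPoint (dualBasisOf A) (w - w')) f f')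
          (translateProduct (basisPoint (dualBasisOf A) (w - w')) g h) y) := by
  set b := dualBasisOf A with hb
  have hcells : basisPoint b w - y - (basisPoint b w' - y) = basisPoint b (w - w') := by
    rw [sub_sub_sub_cancel_right, sub_eq_iff_eq_add, ← basisPoint_add, sub_add_cancel]
  have hparseval := hasSum_fourier_of_support hcells (hf.memLp_mul_conj g y)
    (hf'.memLp_mul_conj h y) (hf.ae_mul_conj_eq_zero g y) (hf'.ae_mul_conj_eq_zero h y)
  rw [hb, volume_real_fundamentalDomain_dualBasisOf] at hparseval
  convert hparseval using 1
  · funext n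
    simp only [← inner_conj_symm f', inner_translation_modulation, character_latticePoint]
  · refine congrArg _ (integral_congr_ae (Eventually.of_forall fun t => ?_))
    simp only [translateProduct, map_mul, Complex.conj_conj, add_sub_right_comm]
    ring

/-- The sum over all windows and frequencies of the products of the short-time Fourier transforms
at the point `y`, evaluated by Parseval's identity for functions `f` and `f'` living on cells of
`A⁻ᵀℤ^m` at distance `x`. -/
noncomputable def gaborKernel (A : Matrix.GeneralLinearGroup (Fin m) ℝ) (x : Eucl m)
    (f f' : L2 m) (g h : Fin L → L2 m) (y : Eucl m) : ℂ :=
  ∑ l, ((|A.1.det|⁻¹ : ℝ) : ℂ) *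
    correlation (translateProduct x f f') (translateProduct x (g l) (h l)) y

/-- The products of short-time Fourier transforms at the point `y` whose sum is the Gabor
kernel. -/
noncomputable def gaborTerm (A : Matrix.GeneralLinearGroup (Fin m) ℝ) (f f' : L2 m)
    (g h : Fin L → L2 m) (y : Eucl m) (j : Fin L × (Fin m → ℤ)) : ℂ :=
  inner ℂ (translation y (modulation (latticePoint A.1 j.2) (g j.1))) f *
    inner ℂ f' (translation y (modulation (latticePoint A.1 j.2) (h j.1)))

variable {g h : Fin L → L2 m}

lemma integrable_gaborKernel (x : Eucl m) : Integrable (gaborKernel A x f f' g h) :=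
  integrable_finsetSum _ fun l _ => (integrable_correlation (integrable_translateProduct x f f')
    (integrable_translateProduct x (g l) (h l))).const_mul _

lemma integral_gaborKernel_mul_conj_character (x ω : Eucl m) :
    ∫ y, gaborKernel A x f f' g h y * conj (character ω y) =
      ((|A.1.det|⁻¹ : ℝ) : ℂ) * (∑ l, inner ℂ (g l) (translation x (modulation ω (h l)))) *
        inner ℂ (translation x (modulation ω f')) f := by
  have hint : ∀ l, Integrable fun y => ((|A.1.det|⁻¹ : ℝ) : ℂ) *
      (correlation (translateProduct x f f') (translateProduct x (g l) (h l)) y *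
        conj (character ω y)) := fun l =>
    (integrable_mul_conj_character (integrable_correlation (integrable_translateProduct x f f')
      (integrable_translateProduct x (g l) (h l))) ω).const_mul _
  simp only [gaborKernel, Finset.sum_mul, mul_assoc]
  rw [integral_finsetSum _ fun l _ => hint l, Finset.mul_sum]
  simp only [integral_const_mul, integral_correlation_translateProduct]
  exact Finset.sum_congr rfl fun l _ => by ring

lemma hasSum_gaborTerm (hf : IsCellFunction (dualBasisOf A) w f)
    (hf' : IsCellFunction (dualBasisOf A) w' f') {y : Eucl m}
    (hs : Summable (gaborTerm A f f' g h y)) :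
    HasSum (gaborTerm A f f' g h y)
      (gaborKernel A (basisPoint (dualBasisOf A) (w - w')) f f' g h y) := by
  have hfiber := hs.hasSum.prod_fiberwise fun l => hasSum_frequencies hf hf' (g l) (h l) y
  rw [gaborKernel, ← hfiber.unique (hasSum_fintype _)]
  exact hs.hasSum

variable {Λ : Set (Eucl m)}

lemma inner_gaborSystem_translation (x : Eucl m) (f : L2 m) (i : Fin L × Λ × (Fin m → ℤ)) :
    inner ℂ (gaborSystem g Λ A.1 i) (translation (-x) f) = inner ℂ
      (translation ((i.2.1 : Eucl m) + x) (modulation (latticePoint A.1 i.2.2) (g i.1))) f := by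
  rw [gaborSystem, ← inner_translation_translation x, translation_translation,
    translation_translation, add_neg_cancel, translation_zero, add_comm x]

lemma inner_gaborSystem_mul_inner_eq_gaborTerm (x : Eucl m) (i : Fin L × Λ × (Fin m → ℤ)) :
    inner ℂ (gaborSystem g Λ A.1 i) (translation (-x) f) *
        inner ℂ (translation (-x) f') (gaborSystem h Λ A.1 i) =
      gaborTerm A f f' g h ((i.2.1 : Eucl m) + x) (i.1, i.2.2) := by
  rw [← inner_conj_symm (translation (-x) f'), inner_gaborSystem_translation,
    inner_gaborSystem_translation, inner_conj_symm, gaborTerm]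

/-- The index set of a Gabor system, with the translation as first component. -/
def gaborIndexEquiv (L : ℕ) (Λ : Set (Eucl m)) :
    Λ × (Fin L × (Fin m → ℤ)) ≃ Fin L × Λ × (Fin m → ℤ) where
  toFun p := (p.2.1, p.1, p.2.2)
  invFun q := (q.2.1, q.1, q.2.2)
  left_inv _ := rfl
  right_inv _ := rfl

theorem hasSum_gaborKernel (hf : IsCellFunction (dualBasisOf A) w f)
    (hf' : IsCellFunction (dualBasisOf A) w' f') {T : L2 m →L[ℂ] L2 m}
    (hT : ∀ f, HasSum (fun i => inner ℂ (gaborSystem g Λ A.1 i) f • gaborSystem h Λ A.1 i) (T f))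
    (x : Eucl m) :
    HasSum (fun y : Λ =>
        gaborKernel A (basisPoint (dualBasisOf A) (w - w')) f f' g h ((y : Eucl m) + x))
      (inner ℂ (translation (-x) f') (T (translation (-x) f))) := by
  have hsum : HasSum (fun p : Λ × (Fin L × (Fin m → ℤ)) =>
      gaborTerm A f f' g h ((p.1 : Eucl m) + x) p.2)
      (inner ℂ (translation (-x) f') (T (translation (-x) f))) := by
    convert (gaborIndexEquiv L Λ).hasSum_iff.2
      (hasSum_inner_frameOperator hT (translation (-x) f) (translation (-x) f')) using 2 with p
    exact (inner_gaborSystem_mul_inner_eq_gaborTerm x (gaborIndexEquiv L Λ p)).symm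
  have hfiber : ∀ y : Λ, HasSum (gaborTerm A f f' g h ((y : Eucl m) + x))
      (gaborKernel A (basisPoint (dualBasisOf A) (w - w')) f f' g h ((y : Eucl m) + x)) :=
    fun y => hasSum_gaborTerm hf hf' (hsum.summable.prod_factor y)
  exact hsum.prod_fiberwise hfiber

lemma exists_hasSum_norm_gaborKernel_le (hf : IsCellFunction (dualBasisOf A) w f)
    (hf' : IsCellFunction (dualBasisOf A) w' f') (hg : IsBessel (gaborSystem g Λ A.1))
    (hh : IsBessel (gaborSystem h Λ A.1)) :
    ∃ M, ∀ x, ∃ s ≤ M, HasSum (fun y : Λ =>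
      ‖gaborKernel A (basisPoint (dualBasisOf A) (w - w')) f f' g h ((y : Eucl m) + x)‖) s := by
  obtain ⟨C, hC⟩ := hg.exists_hasSum_norm_le hh
  refine ⟨C * (‖f‖ ^ 2 + ‖f'‖ ^ 2), fun x => ?_⟩
  obtain ⟨s, hs, hsum⟩ := hC (translation (-x) f) (translation (-x) f')
  have hprod : HasSum (fun p : Λ × (Fin L × (Fin m → ℤ)) =>
      ‖gaborTerm A f f' g h ((p.1 : Eucl m) + x) p.2‖) s := by
    convert (gaborIndexEquiv L Λ).hasSum_iff.2 hsum using 2 with p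
    exact congrArg norm (inner_gaborSystem_mul_inner_eq_gaborTerm x (gaborIndexEquiv L Λ p)).symm
  have hfiber : ∀ y : Λ, HasSum (gaborTerm A f f' g h ((y : Eucl m) + x))
      (gaborKernel A (basisPoint (dualBasisOf A) (w - w')) f f' g h ((y : Eucl m) + x)) :=
    fun y => hasSum_gaborTerm hf hf' (hprod.summable.prod_factor y).of_norm
  obtain ⟨s', hs', hsum'⟩ := exists_hasSum_norm_le_of_prod hprod hfiber
  rw [norm_translation, norm_translation] at hs
  exact ⟨s', hs'.trans hs, hsum'⟩

end GaborKernel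

section Duality

open ComplexConjugate

variable {m L : ℕ} {Γ : Submodule ℤ (Eucl m × ℝ)} {Ω : Set ℝ}
  {A : Matrix.GeneralLinearGroup (Fin m) ℝ} {g h : Fin L → L2 m}

/-- The coefficient of `T_{A⁻ᵀv} M_{p₁*(η)}` in Janssen's representation of the mixed frame operator
of the Gabor systems of `g` and `h` over a model set. -/
noncomputable def janssenCoeff (Γ : Submodule ℤ (Eucl m × ℝ)) (Ω : Set ℝ)
    (A : Matrix.GeneralLinearGroup (Fin m) ℝ) (g h : Fin L → L2 m) (η : Eucl m × ℝ)
    (v : Fin m → ℤ) : ℂ :=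
  (ZLattice.covolume Γ : ℂ)⁻¹ *
    (∫ s in Ω, Complex.exp (2 * Real.pi * Complex.I * ((-η.2 * s : ℝ) : ℂ))) *
    ((|A.1.det|⁻¹ : ℝ) : ℂ) *
    ∑ l, inner ℂ (g l) (translation (latticePoint (A.1.transpose)⁻¹ v) (modulation η.1 (h l)))

lemma inner_translation_modulation_mul_ite {w w' : Fin m → ℤ} {f f' : L2 m}
    (hf : IsCellFunction (dualBasisOf A) w f) (hf' : IsCellFunction (dualBasisOf A) w' f')
    (η : Eucl m × ℝ) :
    (if η = 0 ∧ w - w' = 0 then 1 else 0) *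
      inner ℂ (translation (basisPoint (dualBasisOf A) (w - w')) (modulation η.1 f')) f =
        if η = 0 then inner ℂ f' f else 0 := by
  by_cases hη : η = 0
  · by_cases hw : w = w'
    · simp [hη, hw, basisPoint_zero, translation_zero, modulation_zero]
    · simp [hη, sub_eq_zero, hw, inner_eq_zero_of_cell_ne hf hf' hw]
  · simp [hη]

variable [DiscreteTopology Γ] [IsZLattice ℝ Γ]

theorem inner_frameOperator_translation_eq_iff
    (hinj : Set.InjOn Prod.fst (Γ : Set (Eucl m × ℝ)))
    (hdense : Dense (Prod.snd '' (Γ : Set (Eucl m × ℝ)))) (hbounded : Bornology.IsBounded Ω)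
    (hfrontier : volume (frontier Ω) = 0) (hinterior : (interior Ω).Nonempty)
    (hgen : IsGeneric Γ Ω) (hgB : IsBessel (gaborSystem g (modelSet Γ Ω) A.1))
    (hhB : IsBessel (gaborSystem h (modelSet Γ Ω) A.1)) {T : L2 m →L[ℂ] L2 m}
    (hT : ∀ f, HasSum (fun i => inner ℂ (gaborSystem g (modelSet Γ Ω) A.1 i) f •
      gaborSystem h (modelSet Γ Ω) A.1 i) (T f))
    {w w' : Fin m → ℤ} {f f' : L2 m} (hf : IsCellFunction (dualBasisOf A) w f)
    (hf' : IsCellFunction (dualBasisOf A) w' f') (c : ℂ) :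
    (∀ x, inner ℂ (translation (-x) f') (T (translation (-x) f)) = c) ↔
      ∀ η ∈ dualLattice Γ, janssenCoeff Γ Ω A g h η (w - w') *
        inner ℂ (translation (basisPoint (dualBasisOf A) (w - w')) (modulation η.1 f')) f =
          if η = 0 then c else 0 := by
  set K := gaborKernel A (basisPoint (dualBasisOf A) (w - w')) f f' g h with hK
  have hslice : ∀ x, periodized Γ Ω K (x, 0) =
      inner ℂ (translation (-x) f') (T (translation (-x) f)) := fun x =>
    ((hasSum_windowed_iff hinj).2 (hasSum_gaborKernel hf hf' hT x)).tsum_eq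
  have hbound : StripBounded Γ K := by
    obtain ⟨M, hM⟩ := exists_hasSum_norm_gaborKernel_le hf hf' hgB hhB
    exact stripBounded_of_hasSum_le hinj hdense hinterior hM
  have hcont : Continuous fun x => periodized Γ Ω K (x, 0) := by
    simp only [hslice]
    exact ((continuous_translation f').comp continuous_neg).inner
      (T.continuous.comp ((continuous_translation f).comp continuous_neg))
  have hiff := hbound.periodized_slice_eq_iff hdense hbounded hfrontier hgen
    (integrable_gaborKernel _) hcont c
  simp only [hslice] at hiff
  simp only [hK, integral_gaborKernel_mul_conj_character] at hiff
  simpa only [janssenCoeff, basisPoint_dualBasisOf, mul_assoc] using hiff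

theorem isDualSystem_gaborSystem_iff
    (hinj : Set.InjOn Prod.fst (Γ : Set (Eucl m × ℝ)))
    (hdense : Dense (Prod.snd '' (Γ : Set (Eucl m × ℝ)))) (hbounded : Bornology.IsBounded Ω)
    (hfrontier : volume (frontier Ω) = 0) (hinterior : (interior Ω).Nonempty)
    (hgen : IsGeneric Γ Ω) (hgB : IsBessel (gaborSystem g (modelSet Γ Ω) A.1))
    (hhB : IsBessel (gaborSystem h (modelSet Γ Ω) A.1)) :
    IsDualSystem (gaborSystem h (modelSet Γ Ω) A.1) (gaborSystem g (modelSet Γ Ω) A.1) ↔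
      ∀ η ∈ dualLattice Γ, ∀ v, janssenCoeff Γ Ω A g h η v = if η = 0 ∧ v = 0 then 1 else 0 := by
  obtain ⟨T, hT⟩ := hgB.exists_frameOperator hhB
  have hcoeff {w w' f f'} := inner_frameOperator_translation_eq_iff (w := w) (w' := w') (f := f)
    (f' := f') hinj hdense hbounded hfrontier hinterior hgen hgB hhB hT
  rw [isDualSystem_iff_eq_id hT]
  constructor
  · rintro rfl η hη v
    obtain ⟨f', hf', hne⟩ := exists_isCellFunction_ne_zero (dualBasisOf A) 0
    have hf := hf'.translation_modulation v η.1
    have hmatrix := (hcoeff hf hf' _).1 (fun x => inner_translation_translation (-x) f' _) η hη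
    rw [← inner_translation_modulation_mul_ite hf hf', zero_add, sub_zero] at hmatrix
    refine mul_right_cancel₀ (inner_self_ne_zero.2 ?_) hmatrix
    rwa [← norm_ne_zero_iff, norm_translation, norm_modulation, norm_ne_zero_iff]
  · intro hjanssen
    refine eq_id_of_inner_eq (eq_zero_of_inner_cellFunction_eq_zero (dualBasisOf A)) ?_
    rintro f ⟨w, hf⟩ f' ⟨w', hf'⟩
    have hconst := (hcoeff hf hf' (inner ℂ f' f)).2 fun η hη => by
      rw [hjanssen η hη, inner_translation_modulation_mul_ite hf hf']
    simpa only [neg_zero, translation_zero] using hconst 0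

end Duality

section IntervalWindow

variable {m L : ℕ} {Γ : Submodule ℤ (Eucl m × ℝ)} {Ω : Set ℝ}

lemma IsIntervalWindow.interior_nonempty (hΩ : IsIntervalWindow Ω) : (interior Ω).Nonempty := by
  rw [← closure_nonempty_iff, hΩ.closure_interior]
  exact hΩ.nonempty

lemma IsIntervalWindow.exists_eq_Icc (hΩ : IsIntervalWindow Ω) :
    ∃ c d, c < d ∧ Ω = Set.Icc c d := by
  have hIcc : Ω = Set.Icc (sInf Ω) (sSup Ω) :=
    eq_Icc_of_connected_compact ⟨hΩ.nonempty, hΩ.ordConnected.isPreconnected⟩ hΩ.isCompact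
  refine ⟨sInf Ω, sSup Ω, ?_, hIcc⟩
  have hinterior := hΩ.interior_nonempty
  rw [hIcc, interior_Icc] at hinterior
  exact Set.nonempty_Ioo.1 hinterior

/-- The Fourier transform of an interval is `Φ` up to a phase, which depends on its midpoint. -/
lemma IsIntervalWindow.exists_integral_exp_eq (hΩ : IsIntervalWindow Ω) {ε : ℝ} (hε0 : 0 < ε)
    (hε1 : ε < 1) (t : ℝ) : ∃ z : ℂ, z ≠ 0 ∧ (t = 0 → z = 1) ∧
      ∫ s in Ω, Complex.exp (2 * Real.pi * Complex.I * ((t * s : ℝ) : ℂ)) =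
        z * (volume.real Ω * Phi Ω ε t) := by
  obtain ⟨c, d, hcd, rfl⟩ := hΩ.exists_eq_Icc
  have hvolume : volume.real (Set.Icc c d) = d - c := Real.volume_real_Icc_of_le hcd.le
  refine ⟨Complex.exp (Real.pi * Complex.I * ((t * (c + d) : ℝ) : ℂ)), Complex.exp_ne_zero _,
    fun ht => by simp [ht], ?_⟩
  rw [integral_Icc_eq_integral_Ioc, ← intervalIntegral.integral_of_le hcd.le,
    intervalIntegral_exp_eq_sinc, Phi_eq_sinc (by rw [hvolume]; linarith) hε0 hε1, hvolume]
  push_cast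
  ring

lemma janssenCoeff_eq_ite_iff [DiscreteTopology Γ] [IsZLattice ℝ Γ] (hΩ : IsIntervalWindow Ω)
    {ε : ℝ} (hε0 : 0 < ε) (hε1 : ε < 1) (A : Matrix.GeneralLinearGroup (Fin m) ℝ)
    (g h : Fin L → L2 m) (η : Eucl m × ℝ) (v : Fin m → ℤ) :
    janssenCoeff Γ Ω A g h η v = (if η = 0 ∧ v = 0 then 1 else 0) ↔
      ((volume.real Ω / ZLattice.covolume Γ : ℝ) : ℂ) * ((|A.1.det|⁻¹ : ℝ) : ℂ) *
        (Phi Ω ε (-η.2) : ℂ) * ∑ l, inner ℂ (g l)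
          (translation (latticePoint (A.1.transpose)⁻¹ v) (modulation η.1 (h l))) =
        if η = 0 ∧ v = 0 then 1 else 0 := by
  obtain ⟨z, hz0, hz1, hz⟩ := hΩ.exists_integral_exp_eq hε0 hε1 (-η.2)
  have hphase : z * (if η = 0 ∧ v = 0 then 1 else 0) = if η = 0 ∧ v = 0 then 1 else 0 := by
    split_ifs with hη
    · rw [mul_one, hz1 (by simp [hη.1])]
    · rw [mul_zero]
  have hcoeff : janssenCoeff Γ Ω A g h η v =
      z * (((volume.real Ω / ZLattice.covolume Γ : ℝ) : ℂ) * ((|A.1.det|⁻¹ : ℝ) : ℂ) *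
        (Phi Ω ε (-η.2) : ℂ) * ∑ l, inner ℂ (g l)
          (translation (latticePoint (A.1.transpose)⁻¹ v) (modulation η.1 (h l)))) := by
    rw [janssenCoeff, hz, Complex.ofReal_div]
    ring
  rw [hcoeff]
  exact (Eq.congr_right hphase.symm).trans (mul_right_inj' hz0)

end IntervalWindow

end ModelSetGabor

theorem theorem5p4_general {m L : ℕ}
    (Γ : Submodule ℤ (Eucl m × ℝ)) [DiscreteTopology Γ] [IsZLattice ℝ Γ]
    (hinj : Set.InjOn Prod.fst (Γ : Set (Eucl m × ℝ)))
    (hdense : Dense (Prod.snd '' (Γ : Set (Eucl m × ℝ))))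
    (Ω : Set ℝ) (hΩ : IsIntervalWindow Ω) (hgen : IsGeneric Γ Ω)
    (ε : ℝ) (hε0 : 0 < ε) (hε1 : ε < 1)
    (A : Matrix.GeneralLinearGroup (Fin m) ℝ)
    (g h : Fin L → L2 m)
    (hgB : IsBessel (gaborSystem g (modelSet Γ Ω) A.1))
    (hhB : IsBessel (gaborSystem h (modelSet Γ Ω) A.1)) :
    ∃ D : ℝ, HasDensity (modelSet Γ Ω) D ∧
      (IsDualSystem (gaborSystem h (modelSet Γ Ω) A.1) (gaborSystem g (modelSet Γ Ω) A.1) ↔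
        ∀ (η : dualLattice Γ) (v : Fin m → ℤ),
          (D : ℂ) * ((|A.1.det|⁻¹ : ℝ) : ℂ) * (Phi Ω ε (-(η : Eucl m × ℝ).2) : ℂ) *
            ∑ l, inner ℂ (g l)
              (translation (latticePoint (A.1.transpose)⁻¹ v)
                (modulation (η : Eucl m × ℝ).1 (h l)))
          = if η = 0 ∧ v = 0 then 1 else 0) := by
  have hbounded := hΩ.isCompact.isBounded
  refine ⟨volume.real Ω / ZLattice.covolume Γ,
    hasDensity_modelSet hinj hdense hbounded hΩ.null_frontier, ?_⟩
  rw [isDualSystem_gaborSystem_iff hinj hdense hbounded hΩ.null_frontier hΩ.interior_nonempty hgen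
    hgB hhB]
  refine Subtype.forall'.trans (forall₂_congr fun η v => ?_)
  rw [janssenCoeff_eq_ite_iff hΩ hε0 hε1]
  simp only [Submodule.coe_eq_zero]

theorem theorem5p4 {m L : ℕ}
    (Γ : Submodule ℤ (Eucl m × ℝ)) [DiscreteTopology Γ] [IsZLattice ℝ Γ]
    (hΓ : IsCutAndProject Γ)
    (Ω : Set ℝ) (hΩ : IsIntervalWindow Ω) (hsymm : ∀ x ∈ Ω, -x ∈ Ω) (hgen : IsGeneric Γ Ω)
    (ε : ℝ) (hε0 : 0 < ε) (hε1 : ε < 1)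
    (A : Matrix.GeneralLinearGroup (Fin m) ℝ)
    (g h : Fin L → L2 m)
    (hgW : ∀ l, MemAmalgam (g l)) (hhW : ∀ l, MemAmalgam (h l))
    (hgB : IsBessel (gaborSystem g (modelSet Γ Ω) A.1))
    (hhB : IsBessel (gaborSystem h (modelSet Γ Ω) A.1)) :
    ∃ D : ℝ, HasDensity (modelSet Γ Ω) D ∧
      (IsDualSystem (gaborSystem h (modelSet Γ Ω) A.1) (gaborSystem g (modelSet Γ Ω) A.1) ↔
        ∀ (η : dualLattice Γ) (v : Fin m → ℤ),
          (D : ℂ) * ((|A.1.det|⁻¹ : ℝ) : ℂ) * (Phi Ω ε (-(η : Eucl m × ℝ).2) : ℂ) *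
            ∑ l, inner ℂ (g l)
              (translation (latticePoint (A.1.transpose)⁻¹ v)
                (modulation (η : Eucl m × ℝ).1 (h l)))
          = if η = 0 ∧ v = 0 then 1 else 0) :=
  theorem5p4_general Γ hΓ.injOn_fst hΓ.dense_snd Ω hΩ hgen ε hε0 hε1 A g h hgB hhB
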